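/- Notation. For a finite graded poset $P$ with rank function $r$, $V(P)$ is the complex vector space with basis $P$, $V(P_i)$ is the span of the elements of rank $i$, and the up operator $U$ sends $p$ to the sum of the elements covering $p$. A symmetric Jordan chain is a sequence $(v_1,\dots,v_h)$, $h\ge 1$, of nonzero homogeneous vectors with $U(v_i)=v_{i+1}$, $U(v_h)=0$ and $r(v_1)+r(v_h)=r(P)$; a symmetric Jordan basis (SJB) is a basis of $V(P)$ that is a disjoint union of symmetric Jordan chains. $M(n,k_1,\dots,k_n)=\prod_i\{0,\dots,k_i\}$ with the componentwise order, and $B(n)=M(n,1,\dots,1)$. The linear BTK algorithm. (1) On $V(M(2,p,q))$: if $p=0$ or $q=0$, output the chain $M(2,p,q)$ itself. If $p,q\ge1$, output the chain $(v(0),\dots,v(p+q))$, $v(m)=U^m((0,0))=\sum_{i+j=m}\binom{m}{i}(i,j)$ (over $0\le i\le p$, $0\le j\le q$), together with the images of the chains output for $V(M(2,p-1,q-1))$ under the linear map $(i,j)\mapsto v(i,j+1)$, where $v(i,j)=(p-i)(i,j)-(q-j+1)(i+1,j-1)$. (2) On $V(M(1,k_1))$, output the chain $(0),\dots,(k_1)$.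 For $n\ge2$, each chain $(x_0,\dots,x_l)$ output for $V(M(n-1,k_1,\dots,k_{n-1}))$ is replaced by the images of the chains output for $V(M(2,l,k_n))$ under the linear map $(i,j)\mapsto x_i^{(j)}$, where $x^{(j)}$ is obtained from $x$ by appending $j$ as the $n$-th coordinate of each basis element. Let $O(n)$ be the output for $B(n)$. Representations. $S_n$ acts on $V(B(n))$ by permuting coordinates. $S_i\subseteq S_n$ fixes the letters $i+1,\dots,n$. A Gelfand–Tsetlin (GZ) vector of an $S_n$-module $W$ is a nonzero vector of $L_1$ for some chain $L_1\subseteq\dots\subseteq L_n\subseteq W$ in which each $L_i$ is an irreducible $S_i$-submodule; a GZ-basis of $W$ is a basis of $W$ consisting of one nonzero vector on each line spanned by a GZ vector. Let $X_i=\sum_{j<i}(j\,i)\in\mathbb C[S_n]$ be the Young–Jucys–Murphy elements and, for an $S_n$-module $V$ and $\alpha\in\mathbb C^n$, $V(\alpha)=\{v\in V: X_iv=\alpha_iv,\ 1\le i\le n\}$. Write $\alpha\sim\beta$ if $\alpha$ and $\beta$ are weights of GZ vectors of one and the same irreducible $S_n$-module. For $\alpha\sim\beta$ there is a linear isomorphism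 $f_{\alpha,\beta}:V(\alpha)\to V(\beta)$, unique up to scalars, such that $\mathbb C[S_n]v\cap V(\beta)$ is spanned by $f_{\alpha,\beta}(v)$ for every $v\in V(\alpha)$. Theorem. Let $n\ge 1$. The set $O(n)$ is the symmetric Gelfand–Tsetlin basis of $V(B(n))$; that is: (1) $O(n)$ is an SJB of $V(B(n))$, orthogonal for the inner product making $B(n)$ orthonormal, and for $0\le i\le n$ the set $O(n)\cap V(B(n)_i)$ is a GZ-basis of the $S_n$-module $V(B(n)_i)$. (2) Every vector of $O(n)$ is a simultaneous eigenvector of $X_1,\dots,X_n$; and for $\alpha\sim\beta$ the isomorphism $f_{\alpha,\beta}$ exists and, for every $v\in O(n)\cap V(\alpha)$, some multiple of $f_{\alpha,\beta}(v)$ lies in $O(n)$. (3) $O(n)$ is determined up to scalars by either property: every SJB of $V(B(n))$ satisfying (1), or satisfying (2), in place of $O(n)$ consists of the chains of $O(n)$, each multiplied by a nonzero scalar. -/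

import Mathlib

open scoped ComplexConjugate

noncomputable section

namespace LinearBTK

/-! ## Graded posets and symmetric Jordan bases

For a finite set `P`, the complex vector space `V(P)` with basis `P` is `P →₀ ℂ`; the element `p` of
`P` is the vector `Finsupp.single p 1`. -/

section Poset

variable {P : Type*} [Fintype P] [PartialOrder P]

open Classical in
/-- The up operator: it sends `p` to the sum of the elements covering `p`. -/
def upOp (P : Type*) [Fintype P] [PartialOrder P] : (P →₀ ℂ) →ₗ[ℂ] (P →₀ ℂ) :=
  Finsupp.linearCombination ℂ
    (fun p : P => ∑ q ∈ Finset.univ.filter (fun q => p ⋖ q), Finsupp.single q (1 : ℂ))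

/-- The subspace `V(P_i)` spanned by the elements of rank `i`. -/
def level {P : Type*} (r : P → ℕ) (i : ℕ) : Submodule ℂ (P →₀ ℂ) :=
  Finsupp.supported ℂ ℂ {p | r p = i}

/-- `c = (v_1, …, v_h)` is a symmetric Jordan chain in `V(P)`, where `r` is the rank function
of `P`: the `v_i` are nonzero and homogeneous, `U v_i = v_{i+1}`, `U v_h = 0`, and the ranks of
`v_1` and `v_h` add up to the rank of `P`. -/
structure IsSymmetricJordanChain (r : P → ℕ) (c : List (P →₀ ℂ)) : Prop where
  ne_nil : c ≠ []
  ne_zero : ∀ v ∈ c, v ≠ 0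
  homogeneous : ∀ v ∈ c, ∃ i, v ∈ level r i
  up_eq : c.IsChain (fun v w => upOp P v = w)
  up_last : upOp P (c.getLast ne_nil) = 0
  symmetric : ∃ i j, c.head ne_nil ∈ level r i ∧ c.getLast ne_nil ∈ level r j ∧
    i + j = Finset.univ.sup r

/-- The set of all vectors that occur in the chains of a list of chains. -/
def vectors {V : Type*} (L : List (List V)) : Set V := {v | ∃ c ∈ L, v ∈ c}

/-- The list `L` of chains is a symmetric Jordan basis of `V(P)`: all its chains are symmetric
Jordan chains, and all their vectors together (listed with repetitions) form a basis. -/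
structure IsSJB (r : P → ℕ) (L : List (List (P →₀ ℂ))) : Prop where
  chains : ∀ c ∈ L, IsSymmetricJordanChain r c
  linearIndependent : LinearIndependent ℂ L.flatten.get
  span_eq_top : Submodule.span ℂ (vectors L) = ⊤

/-- The standard inner product on `V(P)`, for which `P` is orthonormal. -/
def stdInner (v w : P →₀ ℂ) : ℂ := ∑ p, conj (v p) * w p

end Poset

/-! ## The linear BTK algorithm -/

/-- The poset `M(n, k_1, …, k_n)` with the componentwise order. -/
abbrev M (n : ℕ) (k : Fin n → ℕ) : Type := (i : Fin n) → Fin (k i + 1)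

/-- The rank function of `M(n, k_1, …, k_n)`. -/
def rk {n : ℕ} {k : Fin n → ℕ} (a : M n k) : ℕ := ∑ i, (a i : ℕ)

/-- The vector `v(m) = U^m (0,0) = ∑ (m choose i) (i,j)`, over `0 ≤ i ≤ p`, `0 ≤ j ≤ q` with
`i + j = m`, of `V(M(2,p,q))`. -/
def mainVec (p q m : ℕ) : Fin (p + 1) × Fin (q + 1) →₀ ℂ :=
  ∑ x : Fin (p + 1) × Fin (q + 1),
    if (x.1 : ℕ) + (x.2 : ℕ) = m then Finsupp.single x (m.choose x.1 : ℂ) else 0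

/-- The linear map `V(M(2,p,q)) → V(M(2,p+1,q+1))`, `(i,j) ↦ v(i,j+1)`, where
`v(i,j) = ((p+1)-i) (i,j) - ((q+1)-j+1) (i+1,j-1)`. -/
def transfer (p q : ℕ) :
    (Fin (p + 1) × Fin (q + 1) →₀ ℂ) →ₗ[ℂ] (Fin (p + 2) × Fin (q + 2) →₀ ℂ) :=
  Finsupp.linearCombination ℂ (fun x : Fin (p + 1) × Fin (q + 1) =>
    Finsupp.single (x.1.castSucc, x.2.succ) ((p : ℂ) + 1 - ((x.1 : ℕ) : ℂ)) -
      Finsupp.single (x.1.succ, x.2.castSucc) ((q : ℂ) + 1 - ((x.2 : ℕ) : ℂ)))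

/-- The algorithm for `V(M(2,p,q))`, where `M(2,p,q)` is written as a product of two chains:
if `p` or `q` is `0`, the chain `M(2,p,q)` itself; otherwise the chain generated by `(0,0)`
together with the transferred chains of `V(M(2,p-1,q-1))`. -/
def btkTwo : (p q : ℕ) → List (List (Fin (p + 1) × Fin (q + 1) →₀ ℂ))
  | 0, q => [List.ofFn fun j : Fin (q + 1) => Finsupp.single (0, j) 1]
  | p + 1, 0 => [List.ofFn fun i : Fin (p + 2) => Finsupp.single (i, 0) 1]
  | p + 1, q + 1 =>
      (List.range (p + q + 3)).map (mainVec (p + 1) (q + 1)) ::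
        (btkTwo p q).map (List.map (transfer p q))

/-- The linear map sending `(a_1, …, a_n)` to `(a_1, …, a_n, j)`. -/
def appendLast {n : ℕ} (k : Fin (n + 1) → ℕ) (j : Fin (k (Fin.last n) + 1)) :
    (M n (fun i => k i.castSucc) →₀ ℂ) →ₗ[ℂ] (M (n + 1) k →₀ ℂ) :=
  Finsupp.lmapDomain ℂ ℂ
    (fun a => (Fin.snoc (α := fun i => Fin (k i + 1)) a j : M (n + 1) k))

/-- For a chain `c = (x_0, …, x_l)`, the linear map sending the element `(i,j)` of
`M(2, l, k_{n+1})` to `x_i` with last coordinate `j` appended. -/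
def place {n : ℕ} (k : Fin (n + 1) → ℕ) (c : List (M n (fun i => k i.castSucc) →₀ ℂ)) :
    (Fin (c.length - 1 + 1) × Fin (k (Fin.last n) + 1) →₀ ℂ) →ₗ[ℂ] (M (n + 1) k →₀ ℂ) :=
  Finsupp.linearCombination ℂ (fun x => appendLast k x.2 (c.getD x.1 0))

/-- The linear BTK algorithm for `M(n, k_1, …, k_n)`, returning a list of chains.  Each chain
`(x_0, …, x_l)` produced for `k_1, …, k_n` is replaced by the chains of `V(M(2, l, k_{n+1}))`,
carried over by `place`.  The recursion starts at the one-point poset `n = 0`; its first step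
yields the chain `0 < 1 < ⋯ < k_1`, and its second step yields `btkTwo k_1 k_2`. -/
def linearBTK : (n : ℕ) → (k : Fin n → ℕ) → List (List (M n k →₀ ℂ))
  | 0, _ => [[Finsupp.single (fun i => i.elim0) 1]]
  | n + 1, k =>
      (linearBTK n (fun i => k i.castSucc)).flatMap fun c =>
        (btkTwo (c.length - 1) (k (Fin.last n))).map (List.map (place k c))

/-- The uniform case `M(n,k)`. -/
abbrev MU (n k : ℕ) : Type := M n (fun _ => k)

/-- The Boolean algebra `B(n) = M(n,1)`. -/
abbrev B (n : ℕ) : Type := MU n 1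

/-- The list of chains `O(n)` produced by the linear BTK algorithm on `B(n)`. -/
def O (n : ℕ) : List (List (B n →₀ ℂ)) := linearBTK n (fun _ => 1)

/-! ## Representations of the symmetric groups -/

section Rep

variable {n : ℕ} {V : Type*} [AddCommGroup V] [Module ℂ V]

/-- The subgroup `S_i` of `S_n`: the permutations fixing all letters but the first `i`. -/
def youngSub (n i : ℕ) : Subgroup (Equiv.Perm (Fin n)) where
  carrier := {π | ∀ j : Fin n, i ≤ (j : ℕ) → π j = j}
  one_mem' := fun _ _ => rfl
  mul_mem' := fun {a b} ha hb j hj => by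
    rw [Equiv.Perm.mul_apply, hb j hj, ha j hj]
  inv_mem' := fun {a} ha j hj => by
    rw [Equiv.Perm.inv_eq_iff_eq, ha j hj]

/-- `W` is invariant under the group `H`. -/
def IsInvariant (ρ : Representation ℂ (Equiv.Perm (Fin n)) V)
    (H : Subgroup (Equiv.Perm (Fin n))) (W : Submodule ℂ V) : Prop :=
  ∀ π ∈ H, ∀ v ∈ W, ρ π v ∈ W

/-- `W` is an irreducible `H`-submodule of `V`. -/
structure IsIrreducibleSub (ρ : Representation ℂ (Equiv.Perm (Fin n)) V)
    (H : Subgroup (Equiv.Perm (Fin n))) (W : Submodule ℂ V) : Prop where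
  invariant : IsInvariant ρ H W
  ne_bot : W ≠ ⊥
  eq_bot_or_eq : ∀ W' ≤ W, IsInvariant ρ H W' → W' = ⊥ ∨ W' = W

/-- `v` is a Gelfand–Tsetlin vector of the `S_n`-submodule `W`: a nonzero vector of `L_1`, for
some chain `L_1 ⊆ L_2 ⊆ ⋯ ⊆ L_n ⊆ W` in which `L_i` is an irreducible `S_i`-submodule. -/
def IsGZVector (ρ : Representation ℂ (Equiv.Perm (Fin n)) V) (W : Submodule ℂ V) (v : V) :
    Prop :=
  v ≠ 0 ∧ ∃ L : ℕ → Submodule ℂ V,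
    (∀ i, 1 ≤ i → i ≤ n → IsIrreducibleSub ρ (youngSub n i) (L i)) ∧
    (∀ i, 1 ≤ i → i < n → L i ≤ L (i + 1)) ∧ L n ≤ W ∧ v ∈ L 1

/-- `S` is a Gelfand–Tsetlin basis of the `S_n`-submodule `W`: a basis of `W` made of one
nonzero vector on each of the lines `L_1` obtained from chains `L_1 ⊆ ⋯ ⊆ L_n ⊆ W` of irreducible
submodules. (When the restrictions are multiplicity free, the irreducible submodules are
the members of the canonical decompositions into irreducibles.) -/
structure IsGZBasis (ρ : Representation ℂ (Equiv.Perm (Fin n)) V) (W : Submodule ℂ V)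
    (S : Set V) : Prop where
  linearIndependent : LinearIndepOn ℂ id S
  span_eq : Submodule.span ℂ S = W
  isGZVector : ∀ v ∈ S, IsGZVector ρ W v
  exists_smul : ∀ v, IsGZVector ρ W v → ∃ u ∈ S, ∃ c : ℂ, v = c • u

/-- The Young–Jucys–Murphy element `X_i = ∑_{j < i} (j i)` of `ℂ[S_n]`. -/
def yjm (n : ℕ) (i : Fin n) : MonoidAlgebra ℂ (Equiv.Perm (Fin n)) :=
  ∑ j ∈ Finset.univ.filter (fun j => j < i),
    MonoidAlgebra.of ℂ (Equiv.Perm (Fin n)) (Equiv.swap j i)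

/-- `v` is a simultaneous eigenvector of `X_1, …, X_n`. -/
def IsYJMEigenvector (ρ : Representation ℂ (Equiv.Perm (Fin n)) V) (v : V) : Prop :=
  v ≠ 0 ∧ ∀ i, ∃ a : ℂ, ρ.asAlgebraHom (yjm n i) v = a • v

/-- The weight space `V(α) = {v | X_i v = α_i v for all i}`. -/
def weightSpace (ρ : Representation ℂ (Equiv.Perm (Fin n)) V) (α : Fin n → ℂ) :
    Submodule ℂ V :=
  ⨅ i, Module.End.eigenspace (ρ.asAlgebraHom (yjm n i)) (α i)

/-- The submodule `ℂ[S_n] v` generated by `v`. -/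
def cyclic (ρ : Representation ℂ (Equiv.Perm (Fin n)) V) (v : V) : Submodule ℂ V :=
  Submodule.span ℂ (Set.range fun π => ρ π v)

/-- `α ∼ β`: the tuples `α` and `β` are weights of Gelfand–Tsetlin vectors of one and the same
irreducible `S_n`-module (in particular both belong to `spec(n)`). -/
def WeightEquiv (n : ℕ) (α β : Fin n → ℂ) : Prop :=
  ∃ (L : Type) (_ : AddCommGroup L) (_ : Module ℂ L) (_ : FiniteDimensional ℂ L)
    (σ : Representation ℂ (Equiv.Perm (Fin n)) L),
    IsIrreducibleSub σ ⊤ ⊤ ∧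
    (∃ v ∈ weightSpace σ α, IsGZVector σ ⊤ v) ∧ (∃ w ∈ weightSpace σ β, IsGZVector σ ⊤ w)

/-- `f` is the canonical isomorphism `f_{α,β} : V(α) → V(β)` (which is unique up to scalars):
for `v ∈ V(α)`, the subspace `ℂ[S_n] v ∩ V(β)` is generated by `f v`. -/
def IsCanonicalIso (ρ : Representation ℂ (Equiv.Perm (Fin n)) V) (α β : Fin n → ℂ)
    (f : weightSpace ρ α ≃ₗ[ℂ] weightSpace ρ β) : Prop :=
  ∀ v : weightSpace ρ α, cyclic ρ (v : V) ⊓ weightSpace ρ β = Submodule.span ℂ {(f v : V)}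

end Rep

/-- The action of `S_n` on `V(M(n,k))` by permutation of coordinates. -/
def permRep (n k : ℕ) : Representation ℂ (Equiv.Perm (Fin n)) (MU n k →₀ ℂ) where
  toFun π := Finsupp.lmapDomain ℂ ℂ (fun (a : MU n k) (i : Fin n) => a (π⁻¹ i))
  map_one' := Finsupp.lhom_ext fun a b => by
    rw [Finsupp.lmapDomain_apply, Finsupp.mapDomain_single]
    rfl
  map_mul' π τ := Finsupp.lhom_ext fun a b => by
    rw [Module.End.mul_apply, Finsupp.lmapDomain_apply, Finsupp.lmapDomain_apply,
      Finsupp.lmapDomain_apply, Finsupp.mapDomain_single, Finsupp.mapDomain_single,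
      Finsupp.mapDomain_single, mul_inv_rev]
    rfl

/-- The list `L` of chains is a symmetric Gelfand–Tsetlin basis of `V(M(n,k))`. -/
structure IsSGZB (n k : ℕ) (L : List (List (MU n k →₀ ℂ))) : Prop where
  isSJB : IsSJB rk L
  eigenvector : ∀ v ∈ vectors L, IsYJMEigenvector (permRep n k) v
  transport : ∀ α β : Fin n → ℂ, WeightEquiv n α β →
    ∃ f : weightSpace (permRep n k) α ≃ₗ[ℂ] weightSpace (permRep n k) β,
      IsCanonicalIso (permRep n k) α β f ∧
      ∀ v : weightSpace (permRep n k) α, (v : MU n k →₀ ℂ) ∈ vectors L →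
        ∃ c : ℂ, c • (f v : MU n k →₀ ℂ) ∈ vectors L

/-- The list `L` of chains is an orthogonal symmetric Jordan basis of `V(B(n))` that is the union
of Gelfand–Tsetlin bases of the `S_n`-modules `V(B(n)_i)`, `0 ≤ i ≤ n`. -/
structure IsGZUnion (n : ℕ) (L : List (List (B n →₀ ℂ))) : Prop where
  isSJB : IsSJB rk L
  orthogonal : ∀ v ∈ vectors L, ∀ w ∈ vectors L, v ≠ w → stdInner v w = 0
  gzBasis : ∀ i ≤ n, IsGZBasis (permRep n 1) (level rk i) {v ∈ vectors L | v ∈ level rk i}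

/-- The two lists consist of the same chains, up to a nonzero scalar for each chain. -/
def SameUpToScalars {V : Type*} [AddCommGroup V] [Module ℂ V] (L L' : List (List V)) : Prop :=
  (∀ c ∈ L, ∃ c' ∈ L', ∃ a : ℂ, a ≠ 0 ∧ c' = c.map (fun v => a • v)) ∧
    (∀ c' ∈ L', ∃ c ∈ L, ∃ a : ℂ, a ≠ 0 ∧ c' = c.map (fun v => a • v))

end LinearBTK

end

open scoped ComplexConjugate

noncomputable section

namespace LinearBTK

/-! ## Operators on the Boolean algebra -/

/-! The rank and `X_1, …, X_n` have simple joint spectrum on `V(B(n))`, and `O(n)` is a joint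
eigenbasis; everything else follows from this.

Write `U` and `D` for `shift n 0 1` and `shift n 1 0`. On `V(B(n+1))`, split by the last coordinate,
`X_{n+1}` is a 2×2 block operator with entries built from `U`, `D` and the rank
(`yjm_last_app_zero`, `yjm_last_app_one`). A chain with bottom rank `k` spans an irreducible module
for the `sl₂` generated by `U` and `D`. One step of the algorithm turns it into the two chains on
which `X_{n+1}` is the scalar `n - k` or `k - 1` (`Good.up`, `Good.down`), the contents of the boxes
that can be added to the two-row shape `(n-k, k)`. As `n - k ≠ k - 1`, different chains have
different weights (`pairwise_wt_ne`), while ranks separate the vectors of one chain.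
Self-adjointness of the `X_i` gives orthogonality, and a count gives a basis.

Hence every homogeneous joint eigenvector of the `X_i` is a multiple of a vector of `O(n)`
(`exists_eq_smul_vec`). Gelfand–Tsetlin vectors are such eigenvectors by a Schur argument
(`IsGZVector.isYJMEigenvector`), so both properties determine the chains (`sameUpToScalars_O`).
Conversely, simple spectrum makes the `S_n`-module generated by a vector of `O(n)` irreducible
(`isIrreducibleSub_cyclic`), and induction on `n` yields the whole Gelfand–Tsetlin chain
(`isGZVector_vec`).

For `α ∼ β` the irreducible module is abstract and must first be found inside `V(B(n))`. The sum of
all `σ`, weighted by their numbers of fixed elements in `B(n)`, acts on a vector of weight `α` by `∏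
(2 + α_i)`. The weights of `O(n)` have entries at least `-1`, so this is nonzero and provides an
equivariant map (`exists_equivariant_ne_zero`). The isomorphism then matches two chains vector by
vector, because `U` commutes with `S_n` (`exists_canonicalIso`). -/

/-- The operator replacing, in all possible ways, one coordinate `s` by `t`. -/
def shift (n : ℕ) (s t : Fin 2) : (B n →₀ ℂ) →ₗ[ℂ] (B n →₀ ℂ) :=
  Finsupp.linearCombination ℂ fun a : B n =>
    ∑ i, if a i = s then Finsupp.single (Function.update a i t : B n) (1 : ℂ) else 0

/-- Appending the last coordinate `s`. -/
def app {n : ℕ} (s : Fin 2) : (B n →₀ ℂ) →ₗ[ℂ] (B (n + 1) →₀ ℂ) :=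
  appendLast (fun _ : Fin (n + 1) => 1) s

lemma shift_single {n : ℕ} (s t : Fin 2) (a : B n) :
    shift n s t (Finsupp.single a 1) =
      ∑ i, if a i = s then Finsupp.single (Function.update a i t : B n) (1 : ℂ) else 0 := by
  simp [shift]

/-- Elements of `B (n + 1)` obtained by appending a coordinate. -/
abbrev snoc {n : ℕ} (a : B n) (s : Fin 2) : B (n + 1) :=
  Fin.snoc (α := fun _ => Fin 2) a s

lemma app_single {n : ℕ} (s : Fin 2) (a : B n) (c : ℂ) :
    app s (Finsupp.single a c) = Finsupp.single (snoc a s) c := by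
  simp [app, appendLast, Finsupp.lmapDomain_apply, Finsupp.mapDomain_single]

lemma covBy_iff_update {n : ℕ} (a b : B n) :
    a ⋖ b ↔ ∃ i, a i = 0 ∧ b = Function.update a i 1 := by
  have key : ∀ x y : Fin 2, x ⋖ y ↔ x = 0 ∧ y = 1 := by
    intro x y
    constructor
    · intro h
      have := h.lt
      omega
    · rintro ⟨rfl, rfl⟩
      refine ⟨by decide, fun c h1 h2 => ?_⟩
      omega
  rw [Pi.covBy_iff_exists_right_eq]
  constructor
  · rintro ⟨i, x, h, rfl⟩
    obtain ⟨h1, rfl⟩ := (key _ _).1 h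
    exact ⟨i, h1, rfl⟩
  · rintro ⟨i, h1, rfl⟩
    exact ⟨i, 1, (key _ _).2 ⟨h1, rfl⟩, rfl⟩

lemma upOp_eq_shift (n : ℕ) : upOp (B n) = shift n 0 1 := by
  classical
  refine Finsupp.lhom_ext' fun a => LinearMap.ext_ring ?_
  simp only [LinearMap.comp_apply, Finsupp.lsingle_apply, shift_single, upOp,
    Finsupp.linearCombination_single, one_smul]
  rw [← Finset.sum_filter]
  symm
  refine Finset.sum_bij (fun i _ => (Function.update a i 1 : B n)) ?_ ?_ ?_ ?_
  · intro i hi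
    simp only [Finset.mem_filter, Finset.mem_univ, true_and] at hi ⊢
    exact (covBy_iff_update _ _).2 ⟨i, hi, rfl⟩
  · intro i hi j hj h
    simp only [Finset.mem_filter, Finset.mem_univ, true_and] at hi hj
    by_contra hij
    have := congrFun h i
    rw [Function.update_self, Function.update_of_ne hij, hi] at this
    exact one_ne_zero this
  · intro b hb
    simp only [Finset.mem_filter, Finset.mem_univ, true_and] at hb
    obtain ⟨i, h1, h2⟩ := (covBy_iff_update _ _).1 hb
    exact ⟨i, by simpa using h1, h2.symm⟩
  · intro i _
    rfl

lemma shift_app_ne {n : ℕ} {s t u : Fin 2} (h : u ≠ s) (v : B n →₀ ℂ) :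
    shift (n + 1) s t (app u v) = app u (shift n s t v) := by
  revert v
  refine LinearMap.congr_fun (f := shift (n + 1) s t ∘ₗ app u) (g := app u ∘ₗ shift n s t) ?_
  refine Finsupp.lhom_ext' fun a => LinearMap.ext_ring ?_
  simp only [LinearMap.comp_apply, Finsupp.lsingle_apply, shift_single, app_single, map_sum]
  rw [Fin.sum_univ_castSucc]
  simp only [snoc, Fin.snoc_castSucc, Fin.snoc_last, h, if_false, add_zero]
  refine Finset.sum_congr rfl fun i _ => ?_
  split_ifs
  · rw [app_single, snoc, Fin.snoc_update]
  · simp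

/-- The sum over coordinates splits into the first `n` and the last one. With `shift_app_ne` this is
the Leibniz rule for `U` and `D` on `V(B(n)) ⊗ ℂ²`. -/
lemma shift_app_self {n : ℕ} (s t : Fin 2) (v : B n →₀ ℂ) :
    shift (n + 1) s t (app s v) = app s (shift n s t v) + app t v := by
  revert v
  refine LinearMap.congr_fun (f := shift (n + 1) s t ∘ₗ app s)
    (g := app s ∘ₗ shift n s t + app t) ?_
  refine Finsupp.lhom_ext' fun a => LinearMap.ext_ring ?_
  simp only [LinearMap.comp_apply, LinearMap.add_apply, Finsupp.lsingle_apply, shift_single,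
    app_single, map_sum]
  rw [Fin.sum_univ_castSucc]
  simp only [snoc, Fin.snoc_castSucc, Fin.snoc_last, if_true, Fin.update_snoc_last]
  congr 1
  refine Finset.sum_congr rfl fun i _ => ?_
  split_ifs
  · rw [app_single, snoc, Fin.snoc_update]
  · simp

lemma app_apply_snoc {n : ℕ} (s t : Fin 2) (v : B n →₀ ℂ) (a : B n) :
    app s v (snoc a t) = if s = t then v a else 0 := by
  induction v using Finsupp.induction_linear with
  | zero => simp
  | add f g hf hg => rw [map_add, Finsupp.add_apply, hf, hg]; split_ifs <;> simp
  | single b c =>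
    rw [app_single, Finsupp.single_apply, Finsupp.single_apply]
    by_cases h : s = t
    · subst h
      simp [snoc, Fin.snoc_inj]
    · simp [snoc, Fin.snoc_inj, h]

lemma eq_zero_of_app_add_app {n : ℕ} {v w : B n →₀ ℂ} (h : app 0 v + app 1 w = 0) :
    v = 0 ∧ w = 0 := by
  constructor
  · ext a
    simpa [app_apply_snoc] using DFunLike.congr_fun h (snoc a 0)
  · ext a
    simpa [app_apply_snoc] using DFunLike.congr_fun h (snoc a 1)

lemma rk_snoc {n : ℕ} (a : B n) (s : Fin 2) : rk (snoc a s) = rk a + s := by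
  simp [rk, snoc, Fin.sum_univ_castSucc]

lemma rk_le {n : ℕ} (a : B n) : rk a ≤ n := by
  calc rk a ≤ ∑ _i : Fin n, 1 := Finset.sum_le_sum fun i _ => Nat.le_of_lt_succ (a i).isLt
    _ = n := by simp

lemma sup_rk (n : ℕ) : Finset.univ.sup (rk : B n → ℕ) = n := by
  refine le_antisymm (Finset.sup_le fun a _ => rk_le a) ?_
  refine le_trans ?_ (Finset.le_sup (Finset.mem_univ (fun _ => 1 : B n)))
  simp [rk]

/-- The operator multiplying each element by its rank. -/
def rankOp (n : ℕ) : (B n →₀ ℂ) →ₗ[ℂ] (B n →₀ ℂ) :=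
  Finsupp.linearCombination ℂ fun a : B n => Finsupp.single a (rk a : ℂ)

lemma rankOp_apply {n : ℕ} (v : B n →₀ ℂ) (a : B n) : rankOp n v a = rk a * v a := by
  induction v using Finsupp.induction_linear with
  | zero => simp
  | add f g hf hg => rw [map_add, Finsupp.add_apply, hf, hg, Finsupp.add_apply, mul_add]
  | single b c =>
    simp only [rankOp, Finsupp.linearCombination_single, Finsupp.smul_single, smul_eq_mul,
      Finsupp.single_apply]
    split_ifs with h
    · rw [h, mul_comm]
    · simp

/-- Homogeneity as an eigenvalue equation, so that the rank can be treated on a par with the `X_i`.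
-/
lemma mem_level_iff {n : ℕ} {r : ℕ} {v : B n →₀ ℂ} :
    v ∈ level rk r ↔ rankOp n v = (r : ℂ) • v := by
  rw [level, Finsupp.mem_supported']
  constructor
  · intro h
    ext a
    rw [rankOp_apply, Finsupp.smul_apply, smul_eq_mul]
    by_cases ha : rk a = r
    · rw [ha]
    · rw [h a ha, mul_zero, mul_zero]
  · intro h a ha
    have := DFunLike.congr_fun h a
    rw [rankOp_apply, Finsupp.smul_apply, smul_eq_mul] at this
    by_contra hv
    exact ha (by exact_mod_cast mul_right_cancel₀ hv this)

lemma level_unique {n : ℕ} {r s : ℕ} {v : B n →₀ ℂ} (hv : v ≠ 0) (h : v ∈ level rk r)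
    (h' : v ∈ level rk s) : r = s := by
  rw [mem_level_iff] at h h'
  exact_mod_cast smul_left_injective ℂ hv (h.symm.trans h')

lemma app_mem_level {n : ℕ} {r : ℕ} (s : Fin 2) {v : B n →₀ ℂ} (h : v ∈ level rk r) :
    app s v ∈ level rk (r + s) := by
  rw [level, Finsupp.mem_supported'] at h ⊢
  intro a ha
  rw [← Fin.snoc_init_self a] at ha ⊢
  change app s v (snoc _ _) = 0
  rw [app_apply_snoc]
  split_ifs with hs
  · refine h _ fun hr => ha ?_
    change rk (snoc _ _) = _
    rw [rk_snoc, hr, ← hs]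
  · rfl

/-! ## The action of the symmetric group -/

lemma permRep_single {n : ℕ} (π : Equiv.Perm (Fin n)) (a : B n) (c : ℂ) :
    permRep n 1 π (Finsupp.single a c) = Finsupp.single (fun i => a (π⁻¹ i) : B n) c := by
  simp [permRep, Finsupp.lmapDomain_apply, Finsupp.mapDomain_single]

lemma permRep_apply {n : ℕ} (π : Equiv.Perm (Fin n)) (v : B n →₀ ℂ) (a : B n) :
    permRep n 1 π v a = v (fun i => a (π i)) := by
  induction v using Finsupp.induction_linear with
  | zero => simp
  | add f g hf hg => rw [map_add, Finsupp.add_apply, hf, hg, Finsupp.add_apply]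
  | single b c =>
    rw [permRep_single, Finsupp.single_apply, Finsupp.single_apply]
    congr 1
    refine propext ⟨?_, ?_⟩
    · rintro rfl
      funext i
      exact congrArg (b : Fin n → Fin 2) (π.symm_apply_apply i).symm
    · rintro rfl
      funext i
      exact congrArg (a : Fin n → Fin 2) (π.apply_symm_apply i)

lemma rk_comp {n : ℕ} (π : Equiv.Perm (Fin n)) (a : B n) : rk (fun i => a (π i) : B n) = rk a :=
  Equiv.sum_comp π fun i => (a i : ℕ)

lemma permRep_mem_level {n : ℕ} {r : ℕ} (π : Equiv.Perm (Fin n)) {v : B n →₀ ℂ}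
    (h : v ∈ level rk r) : permRep n 1 π v ∈ level rk r := by
  rw [level, Finsupp.mem_supported'] at h ⊢
  intro a ha
  rw [permRep_apply]
  exact h _ fun hr => ha ((rk_comp π a).symm.trans hr)

lemma permRep_shift {n : ℕ} (s t : Fin 2) (π : Equiv.Perm (Fin n)) (v : B n →₀ ℂ) :
    permRep n 1 π (shift n s t v) = shift n s t (permRep n 1 π v) := by
  revert v
  refine LinearMap.congr_fun (f := permRep n 1 π ∘ₗ shift n s t)
    (g := shift n s t ∘ₗ permRep n 1 π) ?_
  refine Finsupp.lhom_ext' fun a => LinearMap.ext_ring ?_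
  simp only [LinearMap.comp_apply, Finsupp.lsingle_apply, shift_single, permRep_single, map_sum]
  conv_rhs => rw [← Equiv.sum_comp π]
  refine Finset.sum_congr rfl fun i _ => ?_
  have hi : (a (π⁻¹ (π i)) : Fin 2) = a i :=
    congrArg (a : Fin n → Fin 2) (π.symm_apply_apply i)
  rw [hi]
  split_ifs
  · rw [permRep_single]
    congr 1
    funext j
    by_cases hj : j = π i
    · subst hj; simp
    · rw [Function.update_of_ne hj, Function.update_of_ne]
      rintro rfl
      simp at hj
  · simp

lemma stdInner_permRep {n : ℕ} (π : Equiv.Perm (Fin n)) (v w : B n →₀ ℂ) :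
    stdInner (permRep n 1 π v) w = stdInner v (permRep n 1 π⁻¹ w) := by
  simp only [stdInner, permRep_apply]
  refine Fintype.sum_equiv (Equiv.arrowCongr π.symm (Equiv.refl (Fin 2))) _ _ fun a => ?_
  congr 2
  funext i
  simp

/-- The embedding of `S_n` into `S_{n+1}` as the stabilizer of the last letter. -/
def permCast (n : ℕ) : Equiv.Perm (Fin n) →* Equiv.Perm (Fin (n + 1)) where
  toFun τ :=
    { toFun := Fin.lastCases (Fin.last n) fun i => (τ i).castSucc
      invFun := Fin.lastCases (Fin.last n) fun i => (τ⁻¹ i).castSucc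
      left_inv := fun i => by cases i using Fin.lastCases <;> simp
      right_inv := fun i => by cases i using Fin.lastCases <;> simp }
  map_one' := by ext i; cases i using Fin.lastCases <;> simp
  map_mul' σ τ := by ext i; cases i using Fin.lastCases <;> simp

@[simp] lemma permCast_castSucc {n : ℕ} (τ : Equiv.Perm (Fin n)) (i : Fin n) :
    permCast n τ i.castSucc = (τ i).castSucc := by
  simp [permCast]

@[simp] lemma permCast_last {n : ℕ} (τ : Equiv.Perm (Fin n)) :
    permCast n τ (Fin.last n) = Fin.last n := by
  simp [permCast]

lemma permCast_swap {n : ℕ} (i j : Fin n) :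
    permCast n (Equiv.swap i j) = Equiv.swap i.castSucc j.castSucc := by
  ext k
  cases k using Fin.lastCases with
  | last =>
    rw [permCast_last, Equiv.swap_apply_of_ne_of_ne (Fin.castSucc_ne_last i).symm
      (Fin.castSucc_ne_last j).symm]
  | cast k =>
    rw [permCast_castSucc, Equiv.swap_apply_def, Equiv.swap_apply_def]
    simp only [Fin.castSucc_inj]
    split_ifs <;> rfl

lemma permRep_permCast_app {n : ℕ} (τ : Equiv.Perm (Fin n)) (s : Fin 2) (v : B n →₀ ℂ) :
    permRep (n + 1) 1 (permCast n τ) (app s v) = app s (permRep n 1 τ v) := by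
  ext a
  rw [← Fin.snoc_init_self a]
  rw [permRep_apply]
  have : (fun i => (Fin.snoc (α := fun _ => Fin 2) (Fin.init a) (a (Fin.last n)) :
      Fin (n + 1) → Fin 2) (permCast n τ i)) =
      snoc (fun i => (Fin.init (α := fun _ => Fin 2) a) (τ i)) (a (Fin.last n)) := by
    funext i
    cases i using Fin.lastCases <;> simp [snoc]
  refine (congrArg (app s v) this).trans ?_
  change _ = app s (permRep n 1 τ v) (snoc _ _)
  rw [app_apply_snoc, app_apply_snoc, permRep_apply]

/-! ### Young–Jucys–Murphy elements and their restriction from `n + 1` to `n`. -/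

section YJM

variable {n : ℕ} {V : Type*} [AddCommGroup V] [Module ℂ V]

lemma yjm_apply (ρ : Representation ℂ (Equiv.Perm (Fin n)) V) (i : Fin n) (v : V) :
    ρ.asAlgebraHom (yjm n i) v =
      ∑ j ∈ Finset.univ.filter (fun j => j < i), ρ (Equiv.swap j i) v := by
  simp [yjm, map_sum, LinearMap.sum_apply]

lemma yjm_castSucc_apply (ρ : Representation ℂ (Equiv.Perm (Fin (n + 1))) V) (i : Fin n)
    (v : V) :
    ρ.asAlgebraHom (yjm (n + 1) i.castSucc) v =
      Representation.asAlgebraHom (ρ.comp (permCast n)) (yjm n i) v := by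
  rw [yjm_apply, yjm_apply, Finset.sum_filter, Finset.sum_filter, Fin.sum_univ_castSucc]
  simp only [Fin.castSucc_lt_castSucc_iff, MonoidHom.comp_apply, permCast_swap]
  rw [if_neg (not_lt.2 (Fin.le_last _)), add_zero]

lemma yjm_last_apply (ρ : Representation ℂ (Equiv.Perm (Fin (n + 1))) V) (v : V) :
    ρ.asAlgebraHom (yjm (n + 1) (Fin.last n)) v =
      ∑ j : Fin n, ρ (Equiv.swap j.castSucc (Fin.last n)) v := by
  rw [yjm_apply, Finset.sum_filter, Fin.sum_univ_castSucc]
  simp [Fin.castSucc_lt_last]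

lemma yjm_intertwine {W : Type*} [AddCommGroup W] [Module ℂ W]
    (ρ : Representation ℂ (Equiv.Perm (Fin n)) V)
    (σ : Representation ℂ (Equiv.Perm (Fin n)) W) (φ : V →ₗ[ℂ] W)
    (h : ∀ π v, φ (ρ π v) = σ π (φ v)) (i : Fin n) (v : V) :
    φ (ρ.asAlgebraHom (yjm n i) v) = σ.asAlgebraHom (yjm n i) (φ v) := by
  simp only [yjm_apply, map_sum, h]

end YJM

lemma yjm_castSucc_app {n : ℕ} (i : Fin n) (s : Fin 2) (v : B n →₀ ℂ) :
    (permRep (n + 1) 1).asAlgebraHom (yjm (n + 1) i.castSucc) (app s v) =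
      app s ((permRep n 1).asAlgebraHom (yjm n i) v) := by
  rw [yjm_castSucc_apply]
  simp only [yjm_apply, map_sum, MonoidHom.comp_apply, permRep_permCast_app]

lemma permRep_swap_last_single {n : ℕ} (j : Fin n) (s : Fin 2) (a : B n) :
    permRep (n + 1) 1 (Equiv.swap j.castSucc (Fin.last n)) (Finsupp.single (snoc a s) 1) =
      app (a j) (Finsupp.single (Function.update a j s : B n) 1) := by
  rw [permRep_single, app_single]
  congr 1
  funext i
  rw [Equiv.swap_inv]
  cases i using Fin.lastCases with
  | last => simp [snoc]
  | cast i =>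
    by_cases h : i = j
    · subst h; simp [snoc]
    · rw [Equiv.swap_apply_of_ne_of_ne (by simpa using h) (Fin.castSucc_ne_last i)]
      simp [snoc, Function.update_of_ne h]

lemma natCast_sum_eq_rk {n : ℕ} (a : B n) : (rk a : ℂ) = ∑ j, if a j = 1 then 1 else 0 := by
  rw [rk, Nat.cast_sum]
  refine Finset.sum_congr rfl fun j _ => ?_
  have : ∀ x : Fin 2, ((x : ℕ) : ℂ) = if x = 1 then 1 else 0 := by
    intro x; fin_cases x <;> simp
  exact this (a j)

/-- Exchanging coordinate `j` with a last coordinate `0` does nothing if coordinate `j` is `0`,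
which happens `n - rk a` times; otherwise it lowers coordinate `j` and makes the last one `1`. -/
lemma yjm_last_app_zero {n : ℕ} (v : B n →₀ ℂ) :
    (permRep (n + 1) 1).asAlgebraHom (yjm (n + 1) (Fin.last n)) (app 0 v) =
      app 0 ((n : ℂ) • v - rankOp n v) + app 1 (shift n 1 0 v) := by
  revert v
  refine LinearMap.congr_fun
    (f := (permRep (n + 1) 1).asAlgebraHom (yjm (n + 1) (Fin.last n)) ∘ₗ app 0)
    (g := app 0 ∘ₗ ((n : ℂ) • LinearMap.id - rankOp n) + app 1 ∘ₗ shift n 1 0) ?_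
  refine Finsupp.lhom_ext' fun a => LinearMap.ext_ring ?_
  simp only [LinearMap.comp_apply, LinearMap.add_apply, LinearMap.sub_apply,
    LinearMap.smul_apply, LinearMap.id_apply, Finsupp.lsingle_apply, shift_single,
    app_single, yjm_last_apply, permRep_swap_last_single, map_sum]
  have h1 : rankOp n (Finsupp.single a 1) = (rk a : ℂ) • Finsupp.single a (1 : ℂ) := by
    simp [rankOp]
  -- With `n` and the rank written as sums over coordinates, the identity holds term by term.
  have h2 : (n : ℂ) = ∑ _j : Fin n, 1 := by simp
  rw [h1, ← sub_smul, h2, natCast_sum_eq_rk, ← Finset.sum_sub_distrib, Finset.sum_smul, map_sum,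
    ← Finset.sum_add_distrib]
  refine Finset.sum_congr rfl fun j _ => ?_
  have : ∀ x : Fin 2, x = 0 ∨ x = 1 := by decide
  rcases this (a j) with h | h
  · have : Function.update a j 0 = a := by rw [← h, Function.update_eq_self]
    simp [h, this, app_single]
  · simp [h, app_single]

lemma yjm_last_app_one {n : ℕ} (v : B n →₀ ℂ) :
    (permRep (n + 1) 1).asAlgebraHom (yjm (n + 1) (Fin.last n)) (app 1 v) =
      app 1 (rankOp n v) + app 0 (shift n 0 1 v) := by
  revert v
  refine LinearMap.congr_fun
    (f := (permRep (n + 1) 1).asAlgebraHom (yjm (n + 1) (Fin.last n)) ∘ₗ app 1)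
    (g := app 1 ∘ₗ rankOp n + app 0 ∘ₗ shift n 0 1) ?_
  refine Finsupp.lhom_ext' fun a => LinearMap.ext_ring ?_
  simp only [LinearMap.comp_apply, LinearMap.add_apply, Finsupp.lsingle_apply, shift_single,
    app_single, yjm_last_apply, permRep_swap_last_single, map_sum]
  have h1 : rankOp n (Finsupp.single a 1) = (rk a : ℂ) • Finsupp.single a (1 : ℂ) := by
    simp [rankOp]
  rw [h1, natCast_sum_eq_rk, Finset.sum_smul, map_sum, ← Finset.sum_add_distrib]
  refine Finset.sum_congr rfl fun j _ => ?_
  have : ∀ x : Fin 2, x = 0 ∨ x = 1 := by decide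
  rcases this (a j) with h | h
  · simp [h, app_single]
  · have : Function.update a j 1 = a := by rw [← h, Function.update_eq_self]
    simp [h, this, app_single]

/-! ## Chains labelled by their bottom rank and weight -/

/-- A sequence of vectors of `V(B(n))` together with the rank of its bottom element and its
weight. -/
structure LabelledChain (n : ℕ) where
  /-- The rank of the bottom element. -/
  k : ℕ
  /-- The weight. -/
  wt : Fin n → ℤ
  /-- The vectors, continued by `0`. -/
  vec : ℕ → (B n →₀ ℂ)

namespace LabelledChain

variable {n : ℕ} (t : LabelledChain n)

/-- The longer one of the two chains in the product with a two-element chain. -/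
def up : LabelledChain (n + 1) where
  k := t.k
  wt := Fin.snoc (α := fun _ => ℤ) t.wt (n - t.k)
  vec m := app 0 (t.vec m) + (m : ℂ) • app 1 (t.vec (m - 1))

/-- The shorter one of the two chains in the product with a two-element chain. -/
def down : LabelledChain (n + 1) where
  k := t.k + 1
  wt := Fin.snoc (α := fun _ => ℤ) t.wt (t.k - 1)
  vec m := ((n : ℂ) - 2 * t.k - m) • app 1 (t.vec m) - app 0 (t.vec (m + 1))

/-- The list of the vectors of a chain. -/
def toList : List (B n →₀ ℂ) := (List.range (n - 2 * t.k + 1)).map t.vec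

/-- The properties of a symmetric Jordan chain that consists of weight vectors. -/
structure Good : Prop where
  two_mul_le : 2 * t.k ≤ n
  mem_level : ∀ j, t.vec j ∈ level rk (t.k + j)
  up_eq : ∀ j, shift n 0 1 (t.vec j) = t.vec (j + 1)
  eq_zero : ∀ j, n < 2 * t.k + j → t.vec j = 0
  ne_zero : ∀ j, 2 * t.k + j ≤ n → t.vec j ≠ 0
  down_zero : shift n 1 0 (t.vec 0) = 0
  down_succ : ∀ j : ℕ, shift n 1 0 (t.vec (j + 1)) =
    (((j : ℂ) + 1) * ((n : ℂ) - 2 * t.k - j)) • t.vec j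
  weight : ∀ i j, (permRep n 1).asAlgebraHom (yjm n i) (t.vec j) = (t.wt i : ℂ) • t.vec j
  wt_ge : ∀ i, -1 ≤ t.wt i

variable {t}

/-- For the eigenvalue of `X_{n+1}`: the `app 0` part gets `(n - k - j) + j`, the `app 1` part `j (n
- 2k - j + 1) + j (k + j - 1)`, that is, `n - k` times the coefficients `1` and `j`. The second uses
the constant of `down_succ`, which is why `Good` records `D`. -/
lemma Good.up (h : t.Good) : t.up.Good where
  two_mul_le := by have := h.two_mul_le; simp only [LabelledChain.up]; omega
  mem_level j := by
    refine Submodule.add_mem _ (app_mem_level 0 (h.mem_level j)) ?_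
    cases j with
    | zero => simp
    | succ j => exact Submodule.smul_mem _ _ (app_mem_level 1 (h.mem_level j))
  up_eq j := by
    simp only [LabelledChain.up, map_add, map_smul]
    rw [shift_app_self, shift_app_ne (by decide), h.up_eq]
    -- At index `0` the truncated `j - 1` is harmless, its coefficient being `0`.
    cases j with
    | zero => simp
    | succ j =>
      rw [Nat.add_sub_cancel, Nat.add_sub_cancel, h.up_eq]
      push_cast
      module
  eq_zero j hj := by
    have := h.two_mul_le
    simp only [LabelledChain.up] at hj ⊢
    rw [h.eq_zero _ (by omega), h.eq_zero _ (by omega)]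
    simp
  ne_zero j hj h0 := by
    simp only [LabelledChain.up] at hj h0
    rw [← map_smul] at h0
    obtain ⟨h1, h2⟩ := eq_zero_of_app_add_app h0
    by_cases hj' : 2 * t.k + j ≤ n
    · exact h.ne_zero j hj' h1
    · have := h.two_mul_le
      rcases smul_eq_zero.1 h2 with h3 | h3
      · have h4 : j = 0 := by exact_mod_cast h3
        omega
      · exact h.ne_zero (j - 1) (by omega) h3
  down_zero := by
    simp only [LabelledChain.up]
    simp [shift_app_ne, h.down_zero]
  down_succ j := by
    simp only [LabelledChain.up, map_add, map_smul]
    rw [shift_app_self, shift_app_ne (by decide), h.down_succ, Nat.add_sub_cancel]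
    cases j with
    | zero =>
      simp only [h.down_zero, map_smul, map_zero]
      push_cast
      module
    | succ j =>
      simp only [h.down_succ, map_smul, Nat.add_sub_cancel]
      push_cast
      module
  weight i j := by
    simp only [LabelledChain.up, map_add, map_smul]
    cases i using Fin.lastCases with
    | cast i =>
      rw [yjm_castSucc_app, yjm_castSucc_app, h.weight, h.weight, Fin.snoc_castSucc]
      simp only [map_smul]
      module
    | last =>
      rw [yjm_last_app_zero, yjm_last_app_one, Fin.snoc_last,
        mem_level_iff.1 (h.mem_level j), mem_level_iff.1 (h.mem_level _), h.up_eq]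
      cases j with
      | zero =>
        rw [h.down_zero]
        simp only [map_sub, map_smul, map_zero]
        push_cast
        module
      | succ j =>
        rw [h.down_succ, Nat.add_sub_cancel]
        simp only [map_sub, map_smul]
        push_cast
        module
  wt_ge i := by
    have := h.two_mul_le
    simp only [LabelledChain.up]
    cases i using Fin.lastCases with
    | cast i => rw [Fin.snoc_castSucc]; exact h.wt_ge i
    | last => rw [Fin.snoc_last]; omega

/-- The combination complementary to `up`: with `c = n - 2k - j`, `X_{n+1}` gives `c (k + j) - (j +
1) c = (k - 1) c` on the `app 1` part and `c - (n - k - j - 1) = -(k - 1)` on the `app 0` part. For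
`2k = n` it would vanish. -/
lemma Good.down (h : t.Good) (ht : 2 * t.k < n) : t.down.Good where
  two_mul_le := by simp only [LabelledChain.down]; omega
  mem_level j := by
    have h1 := app_mem_level 1 (h.mem_level j)
    have h2 := app_mem_level 0 (h.mem_level (j + 1))
    refine Submodule.sub_mem _ (Submodule.smul_mem _ _ ?_) ?_
    · rwa [show t.down.k + j = t.k + j + (1 : Fin 2) by
        simp only [LabelledChain.down, Fin.val_one]; omega]
    · rwa [show t.down.k + j = t.k + (j + 1) + (0 : Fin 2) by
        simp only [LabelledChain.down, Fin.val_zero]; omega]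
  up_eq j := by
    simp only [LabelledChain.down, map_sub, map_smul]
    rw [shift_app_self, shift_app_ne (by decide), h.up_eq, h.up_eq]
    push_cast
    module
  eq_zero j hj := by
    simp only [LabelledChain.down] at hj ⊢
    rw [h.eq_zero (j + 1) (by omega), map_zero, sub_zero]
    -- In the boundary case `n = 2k + j` the vector `t.vec j` is the nonzero top of the chain, and
    -- it is the coefficient that vanishes.
    by_cases hj' : n < 2 * t.k + j
    · rw [h.eq_zero j hj', map_zero, smul_zero]
    · have : n = 2 * t.k + j := by omega
      have h0 : (n : ℂ) - 2 * t.k - j = 0 := by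
        have h1 : (n : ℂ) = ((2 * t.k + j : ℕ) : ℂ) := congrArg _ this
        rw [h1]; push_cast; ring
      rw [h0, zero_smul]
  ne_zero j hj h0 := by
    simp only [LabelledChain.down] at hj h0
    rw [sub_eq_neg_add, ← map_smul, ← map_neg (app 0)] at h0
    obtain ⟨-, h2⟩ := eq_zero_of_app_add_app h0
    rcases smul_eq_zero.1 h2 with h3 | h3
    · rw [sub_sub, sub_eq_zero] at h3
      have : n = 2 * t.k + j := by exact_mod_cast h3
      omega
    · exact h.ne_zero _ (by omega) h3
  down_zero := by
    simp only [LabelledChain.down, map_sub, map_smul]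
    rw [shift_app_self, shift_app_ne (by decide), h.down_succ, h.down_zero]
    simp
  down_succ j := by
    simp only [LabelledChain.down, map_sub, map_smul]
    rw [shift_app_self, shift_app_ne (by decide), h.down_succ, h.down_succ]
    simp only [map_smul]
    push_cast
    module
  weight i j := by
    simp only [LabelledChain.down, map_sub, map_smul]
    cases i using Fin.lastCases with
    | cast i =>
      rw [yjm_castSucc_app, yjm_castSucc_app, h.weight, h.weight, Fin.snoc_castSucc]
      simp only [map_smul]
      module
    | last =>
      rw [yjm_last_app_zero, yjm_last_app_one, Fin.snoc_last,
        mem_level_iff.1 (h.mem_level j), mem_level_iff.1 (h.mem_level _), h.up_eq, h.down_succ]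
      simp only [map_sub, map_smul]
      push_cast
      module
  wt_ge i := by
    simp only [LabelledChain.down]
    cases i using Fin.lastCases with
    | cast i => rw [Fin.snoc_castSucc]; exact h.wt_ge i
    | last => rw [Fin.snoc_last]; omega

end LabelledChain

/-- The labelled chains produced by the algorithm. -/
def labelledChains : (n : ℕ) → List (LabelledChain n)
  | 0 => [⟨0, fun i => i.elim0, fun j => if j = 0 then Finsupp.single (fun i => i.elim0) 1 else 0⟩]
  | n + 1 => (labelledChains n).flatMap fun t => if 2 * t.k < n then [t.up, t.down] else [t.up]

lemma mem_labelledChains_succ {n : ℕ} {t : LabelledChain (n + 1)} :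
    t ∈ labelledChains (n + 1) ↔
      ∃ u ∈ labelledChains n, t = u.up ∨ 2 * u.k < n ∧ t = u.down := by
  rw [labelledChains, List.mem_flatMap]
  refine exists_congr fun u => and_congr_right fun _ => ?_
  split_ifs with h <;> simp [h]

lemma good_of_mem {n : ℕ} {t : LabelledChain n} (ht : t ∈ labelledChains n) : t.Good := by
  induction n with
  | zero =>
    obtain rfl : t = _ := by simpa [labelledChains] using ht
    have hs : ∀ s u : Fin 2, shift 0 s u = 0 := fun s u =>
      Finsupp.lhom_ext' fun a => LinearMap.ext_ring (by simp [shift_single])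
    refine ⟨by simp, fun j => ?_, fun j => ?_, fun j hj => ?_, fun j hj => ?_, ?_, fun j => ?_,
      fun i => i.elim0, fun i => i.elim0⟩
    · dsimp only
      split_ifs with h
      · subst h
        exact Finsupp.single_mem_supported _ _ (by simp [rk])
      · exact Submodule.zero_mem _
    · simp [hs]
    · have : j ≠ 0 := by dsimp only at hj; omega
      simp [this]
    · have : j = 0 := by dsimp only at hj; omega
      simp [this]
    · simp [hs]
    · rcases eq_or_ne j 0 with rfl | h <;> simp [*]
  | succ n ih =>
    obtain ⟨u, hu, rfl | ⟨h, rfl⟩⟩ := mem_labelledChains_succ.1 ht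
    · exact (ih hu).up
    · exact (ih hu).down h

/-- Forgetting the last entry of a weight recovers the weight of the parent chain, so only siblings
could collide; `n - k = k - 1` contradicts `2k < n`. -/
lemma pairwise_wt_ne (n : ℕ) :
    (labelledChains n).Pairwise fun t u => t.wt ≠ u.wt := by
  induction n with
  | zero => simp [labelledChains]
  | succ n ih =>
    rw [labelledChains, List.pairwise_flatMap]
    constructor
    · intro t ht
      split_ifs with h
      · simp only [List.pairwise_cons, List.mem_singleton, forall_eq, List.not_mem_nil,
          IsEmpty.forall_iff, implies_true, List.Pairwise.nil, and_true]
        intro h'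
        have := congrFun h' (Fin.last n)
        simp only [LabelledChain.up, LabelledChain.down, Fin.snoc_last] at this
        omega
      · simp
    · refine ih.imp fun {t u} htu x hx y hy h => htu ?_
      have key : ∀ t : LabelledChain n, ∀ x ∈ (if 2 * t.k < n then [t.up, t.down] else [t.up]),
          (fun i : Fin n => x.wt i.castSucc) = t.wt := by
        intro t x hx
        have : x = t.up ∨ x = t.down := by
          split_ifs at hx
          · simpa using hx
          · left; simpa using hx
        rcases this with rfl | rfl <;> funext i <;>
          simp [LabelledChain.up, LabelledChain.down]
      rw [← key t x hx, ← key u y hy, h]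

lemma eq_of_wt_eq {n : ℕ} {t u : LabelledChain n} (ht : t ∈ labelledChains n)
    (hu : u ∈ labelledChains n) (h : t.wt = u.wt) : t = u := by
  have : Std.Symm fun t u : LabelledChain n => t.wt ≠ u.wt := ⟨fun _ _ h => Ne.symm h⟩
  by_contra hne
  exact (pairwise_wt_ne n).forall ht hu hne h

/-! ## The output of the algorithm -/

lemma btkTwo_zero_right (p : ℕ) :
    btkTwo p 0 = [List.ofFn fun i : Fin (p + 1) => Finsupp.single (i, 0) 1] := by
  cases p with
  | zero =>
    simp only [btkTwo]
    congr 2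
    funext i
    fin_cases i
    rfl
  | succ p => rfl

/-- The map `place` for a sequence of vectors in place of a list. -/
def placeSeq {n : ℕ} (x : ℕ → (B n →₀ ℂ)) (p : ℕ) :
    (Fin (p + 1) × Fin (1 + 1) →₀ ℂ) →ₗ[ℂ] (B (n + 1) →₀ ℂ) :=
  Finsupp.linearCombination ℂ fun y => app y.2 (x y.1)

lemma placeSeq_single {n : ℕ} (x : ℕ → (B n →₀ ℂ)) (p : ℕ) (i : Fin (p + 1))
    (s : Fin (1 + 1))
    (c : ℂ) : placeSeq x p (Finsupp.single (i, s) c) = c • app s (x i) := by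
  simp [placeSeq]

/-- The domain of `place` has a type depending on `c.length`. Passing to a sequence and a free `p`
allows `btkTwo p 1` to be unfolded by cases on `p`. -/
lemma btkTwo_map_place {n : ℕ} (c : List (B n →₀ ℂ)) (x : ℕ → (B n →₀ ℂ)) (p : ℕ)
    (hp : c.length - 1 = p) (hx : ∀ i ≤ p, c.getD i 0 = x i) :
    (btkTwo (c.length - 1) 1).map (List.map (place (fun _ : Fin (n + 1) => 1) c)) =
      (btkTwo p 1).map (List.map (placeSeq x p)) := by
  subst hp
  have : place (fun _ : Fin (n + 1) => 1) c = placeSeq x (c.length - 1) := by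
    refine Finsupp.lhom_ext' fun y => LinearMap.ext_ring ?_
    obtain ⟨i, s⟩ := y
    simp only [LinearMap.comp_apply, Finsupp.lsingle_apply]
    rw [placeSeq_single, ← hx i (Nat.le_of_lt_succ i.isLt)]
    simp [place, app]
  rw [this]

/-- Against a two-element chain only `i = m` and `i = m - 1` contribute, with binomial coefficients
`1` and `m`; indices beyond `p + 1` are absent from the sum and covered by `hx`. -/
lemma placeSeq_mainVec {n : ℕ} (x : ℕ → (B n →₀ ℂ)) (p m : ℕ)
    (hx : ∀ i, p + 1 < i → x i = 0) :
    placeSeq x (p + 1) (mainVec (p + 1) 1 m) = app 0 (x m) + (m : ℂ) • app 1 (x (m - 1)) := by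
  have h1 : ∀ q : ℕ, ∀ s : Fin 2, (∑ i : Fin (p + 1 + 1), if (i : ℕ) = q then
      ((m.choose i : ℕ) : ℂ) • app s (x i) else 0) = (m.choose q : ℂ) • app s (x q) := by
    intro q s
    by_cases hq : q < p + 1 + 1
    · rw [Finset.sum_eq_single (⟨q, hq⟩ : Fin (p + 1 + 1))]
      · simp
      · intro i _ hi
        rw [if_neg fun h => hi (Fin.ext h)]
      · simp
    · rw [hx q (by omega), Finset.sum_eq_zero]
      · simp
      · intro i _
        rw [if_neg (by have := i.isLt; omega)]
  rw [mainVec, map_sum, Fintype.sum_prod_type_right, Fin.sum_univ_two]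
  simp only [apply_ite (placeSeq x (p + 1)), map_zero, placeSeq_single, Fin.val_zero, add_zero,
    Fin.val_one]
  congr 1
  · rw [h1, Nat.choose_self, Nat.cast_one, one_smul]
  · cases m with
    | zero => simp
    | succ m =>
      simp only [Nat.add_right_cancel_iff]
      rw [h1, Nat.choose_succ_self_right, Nat.add_sub_cancel]

lemma placeSeq_transfer {n : ℕ} (x : ℕ → (B n →₀ ℂ)) (p : ℕ) (i : Fin (p + 1)) :
    placeSeq x (p + 1) (transfer p 0 (Finsupp.single (i, 0) 1)) =
      (((p + 1 : ℕ) : ℂ) - (i : ℕ)) • app 1 (x i) - app 0 (x (i + 1)) := by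
  simp only [transfer, Finsupp.linearCombination_single, one_smul, map_sub, placeSeq_single]
  simp only [Fin.val_castSucc, Fin.val_succ, Fin.val_zero]
  push_cast
  congr 1
  rw [sub_zero, zero_add, one_smul]

lemma O_eq_map (n : ℕ) : O n = (labelledChains n).map LabelledChain.toList := by
  induction n with
  | zero => simp [O, linearBTK, labelledChains, LabelledChain.toList]
  | succ n ih =>
    have hO : O (n + 1) = (O n).flatMap fun c =>
        (btkTwo (c.length - 1) 1).map (List.map (place (fun _ : Fin (n + 1) => 1) c)) := rfl
    rw [hO, ih, labelledChains, List.flatMap_map, List.map_flatMap]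
    refine List.flatMap_congr fun t ht => ?_
    have hg := good_of_mem ht
    have hk := hg.two_mul_le
    rw [btkTwo_map_place t.toList t.vec (n - 2 * t.k) (by simp [LabelledChain.toList]) (by
      intro i hi
      rw [List.getD_eq_getElem _ _ (by simp [LabelledChain.toList]; omega)]
      simp [LabelledChain.toList])]
    obtain ⟨l, hl⟩ : ∃ l, n - 2 * t.k = l := ⟨_, rfl⟩
    rw [hl]
    -- A one-element chain (`l = 0`) yields only `up`. Otherwise `btkTwo` recurses once, since its
    -- second argument drops from `1` to `0`, and yields `up` and `down`.
    cases l with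
    | zero =>
      rw [if_neg (by omega)]
      have h1 : n + 1 - 2 * t.k = 1 := by omega
      simp only [btkTwo, List.map_cons, List.map_nil, LabelledChain.toList, LabelledChain.up, h1]
      simp only [List.range_succ, List.range_zero, List.ofFn_succ, List.ofFn_zero]
      -- This reduces `t.up.vec 1` to `app 1 (t.vec 0)`.
      have := hg.eq_zero 1 (by omega)
      simp [placeSeq_single, this]
    | succ p =>
      rw [if_pos (by omega)]
      have h1 : n + 1 - 2 * t.k = p + 2 := by omega
      have h2 : n + 1 - 2 * (t.k + 1) = p := by omega
      simp only [btkTwo, btkTwo_zero_right, List.map_cons, List.map_nil, LabelledChain.toList,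
        LabelledChain.up, LabelledChain.down, h1, h2, List.map_map]
      congr 1
      · refine List.map_congr_left fun m _ => ?_
        rw [Function.comp_apply, placeSeq_mainVec _ _ _ fun i hi => hg.eq_zero i (by omega)]
      · congr 1
        rw [List.map_ofFn]
        refine (List.ext_getElem (by simp) fun i _ _ => ?_)
        simp only [List.getElem_ofFn, Function.comp_apply, List.getElem_map, List.getElem_range]
        rw [placeSeq_transfer]
        have h3 : (n : ℂ) = ((2 * t.k + (p + 1) : ℕ) : ℂ) := congrArg _ (by omega)
        rw [h3]
        congr 2
        push_cast
        ring

lemma mem_O_iff {n : ℕ} {c : List (B n →₀ ℂ)} :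
    c ∈ O n ↔ ∃ t ∈ labelledChains n, c = t.toList := by
  rw [O_eq_map, List.mem_map]
  simp only [eq_comm]

lemma LabelledChain.Good.mem_toList {n : ℕ} {t : LabelledChain n} (h : t.Good)
    {v : B n →₀ ℂ} : v ∈ t.toList ↔ ∃ j, 2 * t.k + j ≤ n ∧ v = t.vec j := by
  have := h.two_mul_le
  simp only [LabelledChain.toList, List.mem_map, List.mem_range, eq_comm (b := v)]
  refine exists_congr fun j => and_congr_left fun _ => ?_
  omega

lemma mem_vectors_O {n : ℕ} {v : B n →₀ ℂ} :
    v ∈ vectors (O n) ↔ ∃ t ∈ labelledChains n, ∃ j, 2 * t.k + j ≤ n ∧ v = t.vec j := by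
  constructor
  · rintro ⟨c, hc, hv⟩
    obtain ⟨t, ht, rfl⟩ := mem_O_iff.1 hc
    exact ⟨t, ht, (good_of_mem ht).mem_toList.1 hv⟩
  · rintro ⟨t, ht, h⟩
    exact ⟨t.toList, mem_O_iff.2 ⟨t, ht, rfl⟩, (good_of_mem ht).mem_toList.2 h⟩

/-! ## The output is an orthogonal symmetric Jordan basis -/

section Inner

variable {P : Type*} [Fintype P]

lemma stdInner_smul_left (c : ℂ) (v w : P →₀ ℂ) :
    stdInner (c • v) w = conj c * stdInner v w := by
  simp only [stdInner, Finset.mul_sum, Finsupp.smul_apply, smul_eq_mul, map_mul, mul_assoc]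

lemma stdInner_smul_right (c : ℂ) (v w : P →₀ ℂ) :
    stdInner v (c • w) = c * stdInner v w := by
  simp only [stdInner, Finset.mul_sum, Finsupp.smul_apply, smul_eq_mul]
  exact Finset.sum_congr rfl fun _ _ => by ring

lemma stdInner_sum_left {κ : Type*} (s : Finset κ) (v : κ → (P →₀ ℂ)) (w : P →₀ ℂ) :
    stdInner (∑ i ∈ s, v i) w = ∑ i ∈ s, stdInner (v i) w := by
  simp only [stdInner, Finsupp.finsetSum_apply, map_sum, Finset.sum_mul]
  exact Finset.sum_comm

lemma stdInner_sum_right {κ : Type*} (s : Finset κ) (v : P →₀ ℂ) (w : κ → (P →₀ ℂ)) :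
    stdInner v (∑ i ∈ s, w i) = ∑ i ∈ s, stdInner v (w i) := by
  simp only [stdInner, Finsupp.finsetSum_apply, Finset.mul_sum]
  exact Finset.sum_comm

lemma stdInner_conj (v w : P →₀ ℂ) : conj (stdInner v w) = stdInner w v := by
  simp only [stdInner, map_sum, map_mul, Complex.conj_conj, mul_comm]

lemma stdInner_self_ne_zero {v : P →₀ ℂ} (h : v ≠ 0) : stdInner v v ≠ 0 := by
  intro h0
  apply h
  have h1 : stdInner v v = ((∑ p, Complex.normSq (v p) : ℝ) : ℂ) := by
    simp only [stdInner, Complex.ofReal_sum, Complex.normSq_eq_conj_mul_self]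
  rw [h1, Complex.ofReal_eq_zero,
    Finset.sum_eq_zero_iff_of_nonneg fun p _ => Complex.normSq_nonneg _] at h0
  ext p
  simpa using h0 p (Finset.mem_univ p)

lemma linearIndependent_get_of_orthogonal {l : List (P →₀ ℂ)}
    (h : l.Pairwise fun v w => stdInner v w = 0) (h0 : ∀ v ∈ l, v ≠ 0) :
    LinearIndependent ℂ l.get := by
  rw [List.pairwise_iff_get] at h
  rw [Fintype.linearIndependent_iff]
  intro g hg i
  have h1 : stdInner (l.get i) (∑ j, g j • l.get j) = 0 := by
    rw [hg]; simp [stdInner]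
  rw [stdInner_sum_right, Finset.sum_eq_single i] at h1
  · rw [stdInner_smul_right] at h1
    exact (mul_eq_zero.1 h1).resolve_right (stdInner_self_ne_zero (h0 _ (l.get_mem i)))
  · intro j _ hj
    rw [stdInner_smul_right]
    rcases lt_or_gt_of_ne hj with hlt | hlt
    · rw [← stdInner_conj, h j i hlt, map_zero, mul_zero]
    · rw [h i j hlt, mul_zero]
  · simp

end Inner

/-- Permutations act unitarily and transpositions are involutions, so `X_i` is self-adjoint. -/
lemma stdInner_yjm {n : ℕ} (i : Fin n) (v w : B n →₀ ℂ) :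
    stdInner ((permRep n 1).asAlgebraHom (yjm n i) v) w =
      stdInner v ((permRep n 1).asAlgebraHom (yjm n i) w) := by
  rw [yjm_apply, yjm_apply, stdInner_sum_left, stdInner_sum_right]
  refine Finset.sum_congr rfl fun j _ => ?_
  rw [stdInner_permRep, Equiv.swap_inv]

lemma stdInner_eq_zero_of_wt_ne {n : ℕ} {t u : LabelledChain n} (ht : t.Good) (hu : u.Good)
    (h : t.wt ≠ u.wt) (i j : ℕ) : stdInner (t.vec i) (u.vec j) = 0 := by
  obtain ⟨s, hs⟩ := Function.ne_iff.1 h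
  have h1 := stdInner_yjm s (t.vec i) (u.vec j)
  rw [ht.weight, hu.weight, stdInner_smul_left, stdInner_smul_right, map_intCast] at h1
  by_contra h0
  exact hs (by exact_mod_cast mul_right_cancel₀ h0 h1)

lemma stdInner_eq_zero_of_level_ne {n : ℕ} {r s : ℕ} {v w : B n →₀ ℂ} (hv : v ∈ level rk r)
    (hw : w ∈ level rk s) (h : r ≠ s) : stdInner v w = 0 := by
  rw [level, Finsupp.mem_supported'] at hv hw
  refine Finset.sum_eq_zero fun p _ => ?_
  by_cases hp : rk p = r
  · rw [hw p fun hp' => h (hp.symm.trans hp'), mul_zero]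
  · rw [hv p hp, map_zero, zero_mul]

lemma pairwise_flatten_O (n : ℕ) :
    (O n).flatten.Pairwise fun v w => stdInner v w = 0 := by
  rw [List.pairwise_flatten, O_eq_map, List.pairwise_map]
  constructor
  · intro c hc
    obtain ⟨t, ht, rfl⟩ := List.mem_map.1 hc
    have hg := good_of_mem ht
    rw [LabelledChain.toList, List.pairwise_map]
    refine List.pairwise_lt_range.imp fun {i j} hij => ?_
    exact stdInner_eq_zero_of_level_ne (hg.mem_level i) (hg.mem_level j) (by omega)
  · refine (pairwise_wt_ne n).imp_of_mem fun {t u} ht hu h => ?_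
    intro v hv w hw
    obtain ⟨i, -, rfl⟩ := (good_of_mem ht).mem_toList.1 hv
    obtain ⟨j, -, rfl⟩ := (good_of_mem hu).mem_toList.1 hw
    exact stdInner_eq_zero_of_wt_ne (good_of_mem ht) (good_of_mem hu) h i j

lemma ne_zero_of_mem_vectors_O {n : ℕ} {v : B n →₀ ℂ} (h : v ∈ vectors (O n)) : v ≠ 0 := by
  obtain ⟨t, ht, j, hj, rfl⟩ := mem_vectors_O.1 h
  exact (good_of_mem ht).ne_zero j hj

lemma mem_flatten_iff {V : Type*} {L : List (List V)} {v : V} : v ∈ L.flatten ↔ v ∈ vectors L :=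
  List.mem_flatten

lemma linearIndependent_O (n : ℕ) : LinearIndependent ℂ (O n).flatten.get :=
  linearIndependent_get_of_orthogonal (pairwise_flatten_O n) fun _ hv =>
    ne_zero_of_mem_vectors_O (mem_flatten_iff.1 hv)

/-- A chain of length `h` is replaced by chains of lengths `h + 1` and `h - 1`, the latter omitted
when `h = 1`; the total doubles. -/
lemma length_flatten_O (n : ℕ) : (O n).flatten.length = 2 ^ n := by
  have h : ∀ n, (O n).flatten.length =
      ((labelledChains n).map fun t => n - 2 * t.k + 1).sum := by
    intro n
    rw [List.length_flatten, O_eq_map, List.map_map]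
    congr 1
    refine List.map_congr_left fun t _ => ?_
    simp [LabelledChain.toList]
  induction n with
  | zero => simp [h, labelledChains]
  | succ n ih =>
    rw [h] at ih ⊢
    rw [labelledChains, List.map_flatMap, pow_succ, ← ih]
    have hg : ∀ t ∈ labelledChains n, t.Good := fun t ht => good_of_mem ht
    generalize labelledChains n = l at hg
    clear ih
    induction l with
    | nil => simp
    | cons t l ihl =>
      have h1 := (hg t (by simp)).two_mul_le
      rw [List.flatMap_cons, List.sum_append, List.map_cons, List.sum_cons,
        ihl fun t ht => hg t (List.mem_cons_of_mem _ ht)]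
      split_ifs with h2
      · simp only [List.map_cons, List.map_nil, List.sum_cons, List.sum_nil, LabelledChain.up,
          LabelledChain.down]
        omega
      · simp only [List.map_cons, List.map_nil, List.sum_cons, List.sum_nil, LabelledChain.up]
        omega

lemma range_get_flatten {V : Type*} (L : List (List V)) :
    Set.range L.flatten.get = vectors L := by
  ext v
  rw [Set.range_list_get, Set.mem_ofPred_eq, mem_flatten_iff]

lemma span_vectors_O (n : ℕ) : Submodule.span ℂ (vectors (O n)) = ⊤ := by
  rw [← range_get_flatten]
  refine (linearIndependent_O n).span_eq_top_of_card_eq_finrank' ?_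
  rw [Fintype.card_fin, length_flatten_O, Module.finrank_finsupp_self]
  simp

lemma isSymmetricJordanChain_toList {n : ℕ} {t : LabelledChain n} (h : t.Good) :
    IsSymmetricJordanChain rk t.toList := by
  have hk := h.two_mul_le
  have hne : t.toList ≠ [] := by simp [LabelledChain.toList]
  have hhead : t.toList.head hne = t.vec 0 := by
    simp [LabelledChain.toList, List.head_eq_getElem]
  have hlast : t.toList.getLast hne = t.vec (n - 2 * t.k) := by
    simp [LabelledChain.toList, List.getLast_eq_getElem]
  refine ⟨hne, fun v hv => ?_, fun v hv => ?_, ?_, ?_, ?_⟩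
  · obtain ⟨j, hj, rfl⟩ := h.mem_toList.1 hv
    exact h.ne_zero j hj
  · obtain ⟨j, hj, rfl⟩ := h.mem_toList.1 hv
    exact ⟨_, h.mem_level j⟩
  · rw [List.isChain_iff_getElem]
    intro i hi
    simp [LabelledChain.toList, upOp_eq_shift, h.up_eq]
  · rw [hlast, upOp_eq_shift, h.up_eq, h.eq_zero _ (by omega)]
  · refine ⟨t.k + 0, t.k + (n - 2 * t.k), ?_, ?_, ?_⟩
    · rw [hhead]; exact h.mem_level 0
    · rw [hlast]; exact h.mem_level _
    · rw [sup_rk]; omega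

lemma isSJB_O (n : ℕ) : IsSJB rk (O n) where
  chains c hc := by
    obtain ⟨t, ht, rfl⟩ := mem_O_iff.1 hc
    exact isSymmetricJordanChain_toList (good_of_mem ht)
  linearIndependent := linearIndependent_O n
  span_eq_top := span_vectors_O n

lemma orthogonal_O {n : ℕ} {v w : B n →₀ ℂ} (hv : v ∈ vectors (O n)) (hw : w ∈ vectors (O n))
    (hvw : v ≠ w) : stdInner v w = 0 := by
  obtain ⟨t, ht, i, -, rfl⟩ := mem_vectors_O.1 hv
  obtain ⟨u, hu, j, -, rfl⟩ := mem_vectors_O.1 hw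
  by_cases htu : t = u
  · subst htu
    refine stdInner_eq_zero_of_level_ne ((good_of_mem ht).mem_level i)
      ((good_of_mem ht).mem_level j) ?_
    rintro h
    obtain rfl : i = j := by omega
    exact hvw rfl
  · exact stdInner_eq_zero_of_wt_ne (good_of_mem ht) (good_of_mem hu)
      (fun h => htu (eq_of_wt_eq ht hu h)) i j

/-! ## Weight vectors in terms of the output -/

/-- In a basis of common eigenvectors, a joint eigenvector has nonzero coordinates only at basis
vectors with the same eigenvalues. -/
lemma mem_span_of_eigenvector {κ V : Type*} [AddCommGroup V] [Module ℂ V] {l : List V}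
    (hl : LinearIndependent ℂ l.get) (hl' : Submodule.span ℂ (Set.range l.get) = ⊤)
    (F : κ → V →ₗ[ℂ] V) (a : κ → ℂ) (hF : ∀ i, ∀ x ∈ l, ∃ c : ℂ, F i x = c • x) {v : V}
    (hv : ∀ i, F i v = a i • v) :
    v ∈ Submodule.span ℂ {x | x ∈ l ∧ ∀ i, F i x = a i • x} := by
  set b := Module.Basis.mk hl hl'.ge with hb
  have hbi : ∀ i, b i = l.get i := fun i => by rw [hb, Module.Basis.mk_apply]
  have h1 : v ∈ Submodule.span ℂ (b '' {i | ∀ k, F k (b i) = a k • b i}) := by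
    rw [Module.Basis.mem_span_image]
    intro i hi k
    obtain ⟨c, hc⟩ := hF k (b i) (by rw [hbi]; exact l.get_mem i)
    -- The coordinate functional is an eigenvector of the transpose of `F k`.
    have h2 : b.coord i ∘ₗ F k = c • b.coord i := by
      refine b.ext fun j => ?_
      obtain ⟨d, hd⟩ := hF k (b j) (by rw [hbi]; exact l.get_mem j)
      by_cases hij : j = i
      · subst hij
        simp [hc]
      · simp [hd, Finsupp.single_eq_of_ne, Ne.symm hij]
    have h3 := LinearMap.congr_fun h2 v
    rw [LinearMap.comp_apply, hv k, map_smul, LinearMap.smul_apply, smul_eq_mul,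
      smul_eq_mul] at h3
    have h4 : b.coord i v ≠ 0 := Finsupp.mem_support_iff.1 hi
    rw [hc, mul_right_cancel₀ h4 h3]
  refine Submodule.span_mono ?_ h1
  rintro _ ⟨i, hi, rfl⟩
  exact ⟨by rw [hbi]; exact l.get_mem i, hi⟩

lemma mem_span_O_of_eigenvector {n : ℕ} {κ : Type*} (F : κ → (B n →₀ ℂ) →ₗ[ℂ] (B n →₀ ℂ))
    (a : κ → ℂ) (hF : ∀ i, ∀ x ∈ vectors (O n), ∃ c : ℂ, F i x = c • x) {v : B n →₀ ℂ}
    (hv : ∀ i, F i v = a i • v) :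
    v ∈ Submodule.span ℂ {x | x ∈ vectors (O n) ∧ ∀ i, F i x = a i • x} := by
  have := mem_span_of_eigenvector (linearIndependent_O n)
    (by rw [range_get_flatten, span_vectors_O]) F a
    (fun i x hx => hF i x (mem_flatten_iff.1 hx)) hv
  simpa only [mem_flatten_iff] using this

lemma exists_yjm_eq_smul {n : ℕ} (i : Fin n) {x : B n →₀ ℂ} (hx : x ∈ vectors (O n)) :
    ∃ c : ℂ, (permRep n 1).asAlgebraHom (yjm n i) x = c • x := by
  obtain ⟨t, ht, j, -, rfl⟩ := mem_vectors_O.1 hx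
  exact ⟨_, (good_of_mem ht).weight i j⟩

lemma exists_rankOp_eq_smul {n : ℕ} {x : B n →₀ ℂ} (hx : x ∈ vectors (O n)) :
    ∃ c : ℂ, rankOp n x = c • x := by
  obtain ⟨t, ht, j, -, rfl⟩ := mem_vectors_O.1 hx
  exact ⟨_, mem_level_iff.1 ((good_of_mem ht).mem_level j)⟩

lemma level_le_span {n : ℕ} (r : ℕ) :
    level rk r ≤ Submodule.span ℂ {x | x ∈ vectors (O n) ∧ x ∈ level rk r} := by
  intro v hv
  have := mem_span_O_of_eigenvector (fun _ : Unit => rankOp n) (fun _ => (r : ℂ))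
    (fun _ x hx => exists_rankOp_eq_smul hx) (v := v) fun _ => mem_level_iff.1 hv
  simpa only [forall_const, ← mem_level_iff] using this

lemma mem_weightSpace {n : ℕ} {V : Type*} [AddCommGroup V] [Module ℂ V]
    {ρ : Representation ℂ (Equiv.Perm (Fin n)) V} {α : Fin n → ℂ} {v : V} :
    v ∈ weightSpace ρ α ↔ ∀ i, ρ.asAlgebraHom (yjm n i) v = α i • v := by
  simp [weightSpace, Submodule.mem_iInf]

/-- The weight of a labelled chain as a tuple of complex numbers. -/
def LabelledChain.weight {n : ℕ} (t : LabelledChain n) : Fin n → ℂ := fun i => t.wt i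

lemma LabelledChain.Good.mem_weightSpace {n : ℕ} {t : LabelledChain n} (h : t.Good) (j : ℕ) :
    t.vec j ∈ weightSpace (permRep n 1) t.weight :=
  LinearBTK.mem_weightSpace.2 fun i => h.weight i j

lemma LabelledChain.Good.weight_eq {n : ℕ} {t : LabelledChain n} (h : t.Good) {j : ℕ}
    (hj : 2 * t.k + j ≤ n) {α : Fin n → ℂ} (hα : t.vec j ∈ weightSpace (permRep n 1) α) :
    t.weight = α := by
  funext i
  exact smul_left_injective ℂ (h.ne_zero j hj)
    ((h.weight i j).symm.trans (LinearBTK.mem_weightSpace.1 hα i))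

lemma eq_of_weight_eq {n : ℕ} {t u : LabelledChain n} (ht : t ∈ labelledChains n)
    (hu : u ∈ labelledChains n) (h : t.weight = u.weight) : t = u :=
  eq_of_wt_eq ht hu (funext fun i => by
    have := congrFun h i
    simp only [LabelledChain.weight] at this
    exact_mod_cast this)

lemma weightSpace_le_span {n : ℕ} (α : Fin n → ℂ) : weightSpace (permRep n 1) α ≤
    Submodule.span ℂ {x | x ∈ vectors (O n) ∧ x ∈ weightSpace (permRep n 1) α} := by
  intro v hv
  simpa only [mem_weightSpace] using mem_span_O_of_eigenvector
    (fun i => (permRep n 1).asAlgebraHom (yjm n i)) α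
    (fun i x hx => exists_yjm_eq_smul i hx) (mem_weightSpace.1 hv)

lemma exists_weight_eq {n : ℕ} {α : Fin n → ℂ} (h : weightSpace (permRep n 1) α ≠ ⊥) :
    ∃ t ∈ labelledChains n, t.weight = α := by
  by_contra! hne
  apply h
  rw [eq_bot_iff]
  refine (weightSpace_le_span α).trans (Submodule.span_le.2 ?_)
  rintro x ⟨hx, hx'⟩
  obtain ⟨t, ht, j, hj, rfl⟩ := mem_vectors_O.1 hx
  exact absurd ((good_of_mem ht).weight_eq hj hx') (hne t ht)

lemma weightSpace_eq_span {n : ℕ} {t : LabelledChain n} (ht : t ∈ labelledChains n) :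
    weightSpace (permRep n 1) t.weight =
      Submodule.span ℂ (Set.range fun j : Fin (n - 2 * t.k + 1) => t.vec j) := by
  have hk := (good_of_mem ht).two_mul_le
  refine le_antisymm ((weightSpace_le_span _).trans (Submodule.span_mono ?_))
    (Submodule.span_le.2 ?_)
  · rintro x ⟨hx, hx'⟩
    obtain ⟨u, hu, j, hj, rfl⟩ := mem_vectors_O.1 hx
    obtain rfl := eq_of_weight_eq hu ht ((good_of_mem hu).weight_eq hj hx')
    exact ⟨⟨j, by omega⟩, rfl⟩
  · rintro _ ⟨j, rfl⟩
    exact (good_of_mem ht).mem_weightSpace j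

/-- Simplicity of the joint spectrum: the weight singles out the chain and the rank the position in
it. -/
lemma exists_eq_smul_vec {n : ℕ} {α : Fin n → ℂ} {r : ℕ} {v : B n →₀ ℂ} (h0 : v ≠ 0)
    (hr : v ∈ level rk r) (hα : v ∈ weightSpace (permRep n 1) α) :
    ∃ t ∈ labelledChains n, t.weight = α ∧ ∃ j, 2 * t.k + j ≤ n ∧ t.k + j = r ∧
      ∃ c : ℂ, c ≠ 0 ∧ v = c • t.vec j := by
  -- The index `none` adjoins the rank operator to the family of the `X_i`.
  have h1 := mem_span_O_of_eigenvector (κ := Option (Fin n))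
    (fun i => i.elim (rankOp n) fun i => (permRep n 1).asAlgebraHom (yjm n i))
    (fun i => i.elim (r : ℂ) α)
    (by rintro (_ | i) x hx
        · exact exists_rankOp_eq_smul hx
        · exact exists_yjm_eq_smul i hx) (v := v)
    (by rintro (_ | i)
        · exact mem_level_iff.1 hr
        · exact mem_weightSpace.1 hα i)
  simp only [Option.forall, Option.elim_none, Option.elim_some, ← mem_level_iff,
    ← mem_weightSpace] at h1
  obtain ⟨x, hx, hxr, hxα⟩ : ∃ x, x ∈ vectors (O n) ∧ x ∈ level rk r ∧
      x ∈ weightSpace (permRep n 1) α := by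
    by_contra! hne
    have hE : {x | x ∈ vectors (O n) ∧ x ∈ level rk r ∧ x ∈ weightSpace (permRep n 1) α} =
        (∅ : Set (B n →₀ ℂ)) :=
      Set.eq_empty_of_forall_notMem fun x hx => hne x hx.1 hx.2.1 hx.2.2
    rw [hE, Submodule.span_empty] at h1
    exact h0 h1
  obtain ⟨t, ht, j, hj, rfl⟩ := mem_vectors_O.1 hx
  have hg := good_of_mem ht
  have hjr := level_unique (hg.ne_zero j hj) (hg.mem_level j) hxr
  have h2 : v ∈ Submodule.span ℂ {t.vec j} := by
    refine Submodule.span_mono ?_ h1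
    rintro y ⟨hy, hyr, hyα⟩
    obtain ⟨u, hu, i, hi, rfl⟩ := mem_vectors_O.1 hy
    obtain rfl := eq_of_weight_eq hu ht
      (((good_of_mem hu).weight_eq hi hyα).trans (hg.weight_eq hj hxα).symm)
    have := level_unique (hg.ne_zero i hi) (hg.mem_level i) hyr
    obtain rfl : i = j := by omega
    rfl
  obtain ⟨c, rfl⟩ := Submodule.mem_span_singleton.1 h2
  refine ⟨t, ht, hg.weight_eq hj hxα, j, hj, hjr, c, ?_, rfl⟩
  rintro rfl
  exact h0 (zero_smul _ _)

/-! ## Irreducible submodules generated by vectors -/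

section Irreducible

variable {n m : ℕ} {V W : Type*} [AddCommGroup V] [Module ℂ V] [AddCommGroup W] [Module ℂ W]

/-- The `H`-submodule generated by `v`. -/
def orbitSpan (ρ : Representation ℂ (Equiv.Perm (Fin n)) V)
    (H : Subgroup (Equiv.Perm (Fin n))) (v : V) : Submodule ℂ V :=
  Submodule.span ℂ ((fun π => ρ π v) '' H)

lemma orbitSpan_top (ρ : Representation ℂ (Equiv.Perm (Fin n)) V) (v : V) :
    orbitSpan ρ ⊤ v = cyclic ρ v := by
  simp [orbitSpan, cyclic]

lemma mem_orbitSpan_self (ρ : Representation ℂ (Equiv.Perm (Fin n)) V)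
    (H : Subgroup (Equiv.Perm (Fin n))) (v : V) : v ∈ orbitSpan ρ H v :=
  Submodule.subset_span ⟨1, H.one_mem, by simp⟩

lemma mem_cyclic_self (ρ : Representation ℂ (Equiv.Perm (Fin n)) V) (v : V) :
    v ∈ cyclic ρ v :=
  Submodule.subset_span ⟨1, by simp⟩

lemma orbitSpan_mono (ρ : Representation ℂ (Equiv.Perm (Fin n)) V)
    {H K : Subgroup (Equiv.Perm (Fin n))} (h : H ≤ K) (v : V) :
    orbitSpan ρ H v ≤ orbitSpan ρ K v :=
  Submodule.span_mono (Set.image_mono h)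

lemma cyclic_le {ρ : Representation ℂ (Equiv.Perm (Fin n)) V} {S : Submodule ℂ V}
    (hS : IsInvariant ρ ⊤ S) {v : V} (hv : v ∈ S) : cyclic ρ v ≤ S := by
  refine Submodule.span_le.2 ?_
  rintro _ ⟨π, rfl⟩
  exact hS π trivial v hv

lemma isInvariant_cyclic (ρ : Representation ℂ (Equiv.Perm (Fin n)) V) (v : V) :
    IsInvariant ρ ⊤ (cyclic ρ v) := by
  intro π _ w hw
  have : cyclic ρ v ≤ (cyclic ρ v).comap (ρ π) := by
    refine Submodule.span_le.2 ?_
    rintro _ ⟨τ, rfl⟩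
    exact Submodule.subset_span ⟨π * τ, by simp⟩
  exact this hw

/-- The subgroups `H` and `K` have the same image under their actions, via `φ`. -/
structure Intertwines (ρ : Representation ℂ (Equiv.Perm (Fin n)) V)
    (H : Subgroup (Equiv.Perm (Fin n))) (σ : Representation ℂ (Equiv.Perm (Fin m)) W)
    (K : Subgroup (Equiv.Perm (Fin m))) (φ : V →ₗ[ℂ] W) : Prop where
  exists_right : ∀ π ∈ H, ∃ τ ∈ K, ∀ v, φ (ρ π v) = σ τ (φ v)
  exists_left : ∀ τ ∈ K, ∃ π ∈ H, ∀ v, φ (ρ π v) = σ τ (φ v)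

lemma intertwines_of_commute {ρ : Representation ℂ (Equiv.Perm (Fin n)) V}
    {σ : Representation ℂ (Equiv.Perm (Fin n)) W} {φ : V →ₗ[ℂ] W}
    (h : ∀ π v, φ (ρ π v) = σ π (φ v)) (H : Subgroup (Equiv.Perm (Fin n))) :
    Intertwines ρ H σ H φ :=
  ⟨fun π hπ => ⟨π, hπ, h π⟩, fun π hπ => ⟨π, hπ, h π⟩⟩

variable {ρ : Representation ℂ (Equiv.Perm (Fin n)) V} {H : Subgroup (Equiv.Perm (Fin n))}
  {σ : Representation ℂ (Equiv.Perm (Fin m)) W} {K : Subgroup (Equiv.Perm (Fin m))}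
  {φ : V →ₗ[ℂ] W}

lemma Intertwines.map_orbitSpan (h : Intertwines ρ H σ K φ) (v : V) :
    (orbitSpan ρ H v).map φ = orbitSpan σ K (φ v) := by
  rw [orbitSpan, orbitSpan, Submodule.map_span]
  congr 1
  ext w
  constructor
  · rintro ⟨_, ⟨π, hπ, rfl⟩, rfl⟩
    obtain ⟨τ, hτ, h'⟩ := h.exists_right π hπ
    exact ⟨τ, hτ, (h' v).symm⟩
  · rintro ⟨τ, hτ, rfl⟩
    obtain ⟨π, hπ, h'⟩ := h.exists_left τ hτ
    exact ⟨_, ⟨π, hπ, rfl⟩, h' v⟩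

/-- A submodule `W'` of the image pulls back to the invariant submodule `L ⊓ W'.comap φ` of `L`.
Allowing two different groups covers both powers of `U` and the passage from `B(n)` to `B(n+1)`. -/
lemma Intertwines.isIrreducibleSub_map (h : Intertwines ρ H σ K φ) {L : Submodule ℂ V}
    (hL : IsIrreducibleSub ρ H L) (h0 : L.map φ ≠ ⊥) : IsIrreducibleSub σ K (L.map φ) where
  invariant := by
    rintro τ hτ _ ⟨v, hv, rfl⟩
    obtain ⟨π, hπ, h'⟩ := h.exists_left τ hτ
    exact ⟨ρ π v, hL.invariant π hπ v hv, h' v⟩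
  ne_bot := h0
  eq_bot_or_eq W' hW' hinv := by
    have hinv' : IsInvariant ρ H (L ⊓ W'.comap φ) := by
      rintro π hπ v ⟨hv, hv'⟩
      obtain ⟨τ, hτ, h'⟩ := h.exists_right π hπ
      refine ⟨hL.invariant π hπ v hv, ?_⟩
      rw [SetLike.mem_coe, Submodule.mem_comap, h']
      exact hinv τ hτ _ hv'
    rcases hL.eq_bot_or_eq _ inf_le_left hinv' with h1 | h1
    · left
      rw [eq_bot_iff]
      intro w hw
      obtain ⟨v, hv, rfl⟩ := hW' hw
      have : v ∈ L ⊓ W'.comap φ := ⟨hv, hw⟩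
      rw [h1, Submodule.mem_bot] at this
      rw [this, map_zero]
      exact Submodule.zero_mem _
    · right
      refine le_antisymm hW' ?_
      rw [Submodule.map_le_iff_le_comap]
      exact h1.symm.le.trans inf_le_right

lemma Intertwines.isIrreducibleSub_orbitSpan (h : Intertwines ρ H σ K φ) {v : V}
    (hv : IsIrreducibleSub ρ H (orbitSpan ρ H v)) (h0 : φ v ≠ 0) :
    IsIrreducibleSub σ K (orbitSpan σ K (φ v)) := by
  rw [← h.map_orbitSpan]
  refine h.isIrreducibleSub_map hv fun h1 => h0 ?_
  have : φ v ∈ (orbitSpan ρ H v).map φ := ⟨v, mem_orbitSpan_self ρ H v, rfl⟩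
  rwa [h1, Submodule.mem_bot] at this

lemma IsIrreducibleSub.cyclic_eq {L : Submodule ℂ V} (hL : IsIrreducibleSub ρ ⊤ L) {v : V}
    (hv : v ∈ L) (h0 : v ≠ 0) : cyclic ρ v = L :=
  (hL.eq_bot_or_eq _ (cyclic_le hL.invariant hv) (isInvariant_cyclic ρ v)).resolve_left
    fun h => h0 (by simpa [h] using mem_cyclic_self ρ v)

/-- A linear map commuting with the group is injective on an irreducible submodule unless it
vanishes there. -/
lemma IsIrreducibleSub.eq_zero_of_map_eq_zero {σ : Representation ℂ (Equiv.Perm (Fin n)) W}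
    (hφ : ∀ π v, φ (ρ π v) = σ π (φ v))
    {L : Submodule ℂ V} (hL : IsIrreducibleSub ρ ⊤ L) {v : V} (hv : v ∈ L) (h0 : φ v ≠ 0)
    {w : V} (hw : w ∈ L) (hw0 : φ w = 0) : w = 0 := by
  have hinv : IsInvariant ρ ⊤ (L ⊓ LinearMap.ker φ) := by
    rintro π hπ u ⟨hu, hu'⟩
    refine ⟨hL.invariant π hπ u hu, ?_⟩
    rw [SetLike.mem_coe, LinearMap.mem_ker] at hu' ⊢
    rw [hφ, hu', map_zero]
  rcases hL.eq_bot_or_eq _ inf_le_left hinv with h1 | h1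
  · have : w ∈ L ⊓ LinearMap.ker φ := ⟨hw, hw0⟩
    rwa [h1, Submodule.mem_bot] at this
  · rw [← h1] at hv
    exact absurd hv.2 h0

/-- Maschke's argument: average a linear projection over the group. -/
lemma exists_equivariant_projection (ρ : Representation ℂ (Equiv.Perm (Fin n)) V)
    {S : Submodule ℂ V} (hS : IsInvariant ρ ⊤ S) :
    ∃ P : V →ₗ[ℂ] V, (∀ π v, P (ρ π v) = ρ π (P v)) ∧ (∀ v, P v ∈ S) ∧ ∀ v ∈ S, P v = v := by
  obtain ⟨p, hp⟩ := S.subtype.exists_leftInverse_of_injective S.ker_subtype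
  have hp' : ∀ v ∈ S, (p v : V) = v := fun v hv =>
    congrArg Subtype.val (LinearMap.congr_fun hp ⟨v, hv⟩)
  have hcard : (Fintype.card (Equiv.Perm (Fin n)) : ℂ) ≠ 0 :=
    Nat.cast_ne_zero.2 Fintype.card_ne_zero
  let P : V →ₗ[ℂ] V := (Fintype.card (Equiv.Perm (Fin n)) : ℂ)⁻¹ •
    ∑ π, ρ π ∘ₗ S.subtype ∘ₗ p ∘ₗ ρ π⁻¹
  have hP : ∀ v, P v = (Fintype.card (Equiv.Perm (Fin n)) : ℂ)⁻¹ •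
      ∑ π, ρ π (p (ρ π⁻¹ v)) := fun v => by
    simp [P, LinearMap.sum_apply]
  refine ⟨P, fun τ v => ?_, fun v => ?_, fun v hv => ?_⟩
  · rw [hP, hP, map_smul, map_sum, ← Equiv.sum_comp (Equiv.mulLeft τ)]
    congr 1
    refine Finset.sum_congr rfl fun π _ => ?_
    simp only [Equiv.coe_mulLeft, mul_inv_rev, map_mul, Module.End.mul_apply]
    rw [← Module.End.mul_apply (ρ τ⁻¹), ← map_mul, inv_mul_cancel, map_one, Module.End.one_apply]
  · rw [hP]
    exact S.smul_mem _ (S.sum_mem fun π _ => hS π trivial _ (p _).2)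
  · rw [hP]
    have : ∀ π, ρ π (p (ρ π⁻¹ v)) = v := fun π => by
      rw [hp' _ (hS _ trivial v hv), ← Module.End.mul_apply, ← map_mul, mul_inv_cancel, map_one,
        Module.End.one_apply]
    simp only [this, Finset.sum_const, Finset.card_univ]
    rw [← Nat.cast_smul_eq_nsmul ℂ, smul_smul, inv_mul_cancel₀ hcard, one_smul]

end Irreducible

lemma isInvariant_level (n r : ℕ) (H : Subgroup (Equiv.Perm (Fin n))) :
    IsInvariant (permRep n 1) H (level rk r) :=
  fun π _ _ hv => permRep_mem_level π hv

lemma exists_smul_of_mem_cyclic {n : ℕ} {t : LabelledChain n} (ht : t ∈ labelledChains n) {j : ℕ}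
    {y : B n →₀ ℂ} (hy : y ∈ cyclic (permRep n 1) (t.vec j))
    (hy' : y ∈ weightSpace (permRep n 1) t.weight) : ∃ c : ℂ, y = c • t.vec j := by
  have hg := good_of_mem ht
  by_cases h0 : y = 0
  · exact ⟨0, by simp [h0]⟩
  · obtain ⟨u, hu, huw, i, hi, hir, c, -, rfl⟩ := exists_eq_smul_vec h0
      (cyclic_le (isInvariant_level n _ _) (hg.mem_level j) hy) hy'
    obtain rfl := eq_of_weight_eq hu ht huw
    obtain rfl : i = j := by omega
    exact ⟨c, rfl⟩

/-- An equivariant projection onto a submodule preserves weights, and the generated module lies in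
one rank, so the generator goes to a multiple `c` of itself. The submodule is zero or everything
according to whether `c = 0`. -/
lemma isIrreducibleSub_cyclic {n : ℕ} {t : LabelledChain n} (ht : t ∈ labelledChains n) {j : ℕ}
    (hj : 2 * t.k + j ≤ n) :
    IsIrreducibleSub (permRep n 1) ⊤ (cyclic (permRep n 1) (t.vec j)) where
  invariant := isInvariant_cyclic _ _
  ne_bot h := (good_of_mem ht).ne_zero j hj
    (by simpa [h] using mem_cyclic_self (permRep n 1) (t.vec j))
  eq_bot_or_eq S hS hinv := by
    obtain ⟨P, hP1, hP2, hP3⟩ := exists_equivariant_projection (permRep n 1) hinv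
    have hPw : P (t.vec j) ∈ weightSpace (permRep n 1) t.weight := by
      rw [mem_weightSpace]
      intro i
      rw [← yjm_intertwine _ _ P hP1, mem_weightSpace.1 ((good_of_mem ht).mem_weightSpace j),
        map_smul]
    obtain ⟨c, hc⟩ := exists_smul_of_mem_cyclic ht (hS (hP2 _)) hPw
    by_cases h0 : c = 0
    · left
      rw [eq_bot_iff]
      intro v hv
      have hker : cyclic (permRep n 1) (t.vec j) ≤ LinearMap.ker P := by
        refine Submodule.span_le.2 ?_
        rintro _ ⟨π, rfl⟩
        rw [SetLike.mem_coe, LinearMap.mem_ker, hP1, hc, h0, zero_smul, map_zero]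
      rw [Submodule.mem_bot, ← hP3 v hv]
      exact hker (hS hv)
    · right
      refine le_antisymm hS (cyclic_le hinv ?_)
      have := S.smul_mem c⁻¹ (hP2 (t.vec j))
      rwa [hc, smul_smul, inv_mul_cancel₀ h0, one_smul] at this

/-! ## Young subgroups -/

lemma permCast_injective (n : ℕ) : Function.Injective (permCast n) := by
  intro σ τ h
  ext i
  have := congrArg (fun π : Equiv.Perm (Fin (n + 1)) => π i.castSucc) h
  simpa [Fin.ext_iff] using this

/-- Coset representatives of `S_n` in `S_{n+1}`: the second factor is determined by the preimage of
the last letter. -/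
lemma bijective_permCast_mul_swap (n : ℕ) :
    Function.Bijective fun x : Equiv.Perm (Fin n) × Fin (n + 1) =>
      permCast n x.1 * Equiv.swap x.2 (Fin.last n) := by
  rw [Fintype.bijective_iff_injective_and_card]
  constructor
  · rintro ⟨σ, i⟩ ⟨τ, j⟩ h
    dsimp only at h
    have key : ∀ (σ : Equiv.Perm (Fin n)) (i : Fin (n + 1)),
        (permCast n σ * Equiv.swap i (Fin.last n)) i = Fin.last n := by
      intro σ i; simp
    have hij : i = j := by
      apply (permCast n σ * Equiv.swap i (Fin.last n)).injective
      rw [key, h, key]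
    subst hij
    rw [permCast_injective n (mul_right_cancel h)]
  · simp [Fintype.card_perm, Nat.factorial_succ, mul_comm]

lemma permCast_mem_youngSub {n i : ℕ} {τ : Equiv.Perm (Fin n)} (hτ : τ ∈ youngSub n i) :
    permCast n τ ∈ youngSub (n + 1) i := by
  intro j hj
  cases j using Fin.lastCases with
  | last => simp
  | cast j => rw [permCast_castSucc, hτ j (by simpa using hj)]

lemma exists_permCast_eq {n i : ℕ} {σ : Equiv.Perm (Fin (n + 1))} (hσ : σ ∈ youngSub (n + 1) i)
    (hi : i ≤ n) : ∃ τ ∈ youngSub n i, permCast n τ = σ := by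
  obtain ⟨⟨τ, j⟩, h⟩ := (bijective_permCast_mul_swap n).2 σ
  dsimp only at h
  have h1 : σ (Fin.last n) = Fin.last n := hσ _ (by simpa using hi)
  have h2 : σ j = Fin.last n := by rw [← h]; simp
  obtain rfl : j = Fin.last n := σ.injective (h2.trans h1.symm)
  rw [Equiv.swap_self] at h
  have h3 : permCast n τ = σ := h
  refine ⟨τ, fun j hj => ?_, h3⟩
  have := hσ j.castSucc (by simpa using hj)
  rw [← h3, permCast_castSucc] at this
  exact Fin.castSucc_injective _ this

lemma youngSub_self (n : ℕ) : youngSub n n = ⊤ := by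
  rw [eq_top_iff]
  intro π _ j hj
  exact absurd j.isLt (not_lt.2 hj)

lemma youngSub_mono (n : ℕ) {i j : ℕ} (h : i ≤ j) : youngSub n i ≤ youngSub n j :=
  fun _ hπ k hk => hπ k (h.trans hk)

lemma intertwines_of_permCast {n i : ℕ} (hi : i ≤ n) {φ : (B n →₀ ℂ) →ₗ[ℂ] (B (n + 1) →₀ ℂ)}
    (h : ∀ τ v, φ (permRep n 1 τ v) = permRep (n + 1) 1 (permCast n τ) (φ v)) :
    Intertwines (permRep n 1) (youngSub n i) (permRep (n + 1) 1) (youngSub (n + 1) i) φ where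
  exists_right τ hτ := ⟨permCast n τ, permCast_mem_youngSub hτ, h τ⟩
  exists_left σ hσ := by
    obtain ⟨τ, hτ, rfl⟩ := exists_permCast_eq hσ hi
    exact ⟨τ, hτ, h τ⟩

/-! ## Gelfand–Tsetlin vectors -/

/-- A bottom vector for `n + 1` is the image of one for `n` under an `S_n`-equivariant map, which
transports irreducibility for `i ≤ n`; the full group is covered by `isIrreducibleSub_cyclic`. -/
lemma isIrreducibleSub_orbitSpan_zero {n : ℕ} {t : LabelledChain n} (ht : t ∈ labelledChains n)
    {i : ℕ} (hi : i ≤ n) : IsIrreducibleSub (permRep n 1) (youngSub n i)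
      (orbitSpan (permRep n 1) (youngSub n i) (t.vec 0)) := by
  induction n with
  | zero =>
    obtain rfl : i = 0 := by omega
    rw [youngSub_self, orbitSpan_top]
    exact isIrreducibleSub_cyclic ht (good_of_mem ht).two_mul_le
  | succ n ih =>
    rcases hi.lt_or_eq with hi' | rfl
    · have h0 := (good_of_mem ht).ne_zero 0 (good_of_mem ht).two_mul_le
      obtain ⟨u, hu, h⟩ := mem_labelledChains_succ.1 ht
      obtain ⟨φ, hφ, hφ'⟩ : ∃ φ : (B n →₀ ℂ) →ₗ[ℂ] (B (n + 1) →₀ ℂ),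
          (∀ τ v, φ (permRep n 1 τ v) = permRep (n + 1) 1 (permCast n τ) (φ v)) ∧
            t.vec 0 = φ (u.vec 0) := by
        rcases h with rfl | ⟨-, rfl⟩
        · exact ⟨app 0, fun τ v => (permRep_permCast_app τ 0 v).symm,
            by simp [LabelledChain.up]⟩
        · refine ⟨((n : ℂ) - 2 * u.k) • app 1 - app 0 ∘ₗ shift n 0 1, fun τ v => ?_, ?_⟩
          · simp only [LinearMap.sub_apply, LinearMap.smul_apply, LinearMap.comp_apply, map_sub,
              map_smul, permRep_permCast_app, permRep_shift]
          · simp [LabelledChain.down, (good_of_mem hu).up_eq]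
      rw [hφ'] at h0 ⊢
      exact (intertwines_of_permCast (Nat.le_of_lt_succ hi') hφ).isIrreducibleSub_orbitSpan
        (ih hu (Nat.le_of_lt_succ hi')) h0
    · rw [youngSub_self, orbitSpan_top]
      exact isIrreducibleSub_cyclic ht (good_of_mem ht).two_mul_le

lemma shift_pow_vec {n : ℕ} {t : LabelledChain n} (h : t.Good) (i j : ℕ) :
    (shift n 0 1 ^ i) (t.vec j) = t.vec (j + i) := by
  induction i with
  | zero => simp
  | succ i ih => rw [pow_succ', Module.End.mul_apply, ih, h.up_eq, add_assoc]

lemma permRep_shift_pow {n : ℕ} (i : ℕ) (π : Equiv.Perm (Fin n)) (v : B n →₀ ℂ) :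
    (shift n 0 1 ^ i) (permRep n 1 π v) = permRep n 1 π ((shift n 0 1 ^ i) v) := by
  induction i with
  | zero => simp
  | succ i ih => rw [pow_succ', Module.End.mul_apply, ih, Module.End.mul_apply, permRep_shift]

lemma isGZVector_vec {n : ℕ} {t : LabelledChain n} (ht : t ∈ labelledChains n) {j : ℕ}
    (hj : 2 * t.k + j ≤ n) : IsGZVector (permRep n 1) (level rk (t.k + j)) (t.vec j) := by
  have hg := good_of_mem ht
  refine ⟨hg.ne_zero j hj, fun i => orbitSpan (permRep n 1) (youngSub n i) (t.vec j),
    fun i _ hi => ?_, fun i _ _ => orbitSpan_mono _ (youngSub_mono n i.le_succ) _, ?_,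
    mem_orbitSpan_self _ _ _⟩
  -- The equivariant operator `U^j` carries the result from the bottom of the chain to position `j`.
  · have h1 : t.vec j = (shift n 0 1 ^ j) (t.vec 0) := by rw [shift_pow_vec hg, zero_add]
    have h2 := hg.ne_zero j hj
    dsimp only
    rw [h1] at h2 ⊢
    exact (intertwines_of_commute (permRep_shift_pow j) _).isIrreducibleSub_orbitSpan
      (isIrreducibleSub_orbitSpan_zero ht hi) h2
  · dsimp only
    rw [youngSub_self, orbitSpan_top]
    exact cyclic_le (isInvariant_level n _ _) (hg.mem_level j)

/-! ### Gelfand–Tsetlin vectors are joint eigenvectors of the Young–Jucys–Murphy elements. -/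

section Schur

variable {n : ℕ} {V : Type*} [AddCommGroup V] [Module ℂ V]

/-- The sum of the operators of all `(a b)`, `a, b` among the first `i` letters. -/
def swapSum (ρ : Representation ℂ (Equiv.Perm (Fin n)) V) (i : ℕ) : V →ₗ[ℂ] V :=
  ∑ a ∈ Finset.univ.filter (fun a : Fin n => (a : ℕ) < i),
    ∑ b ∈ Finset.univ.filter (fun b : Fin n => (b : ℕ) < i), ρ (Equiv.swap a b)

/-- The sum is over ordered pairs, so the new letter contributes `X_i` twice and the diagonal term
`1`. Thus `X_i` is recovered from operators commuting with `S_i` and `S_{i+1}` respectively. -/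
lemma swapSum_succ (ρ : Representation ℂ (Equiv.Perm (Fin n)) V) (i : Fin n) :
    swapSum ρ (i + 1) = swapSum ρ i + (2 : ℂ) • ρ.asAlgebraHom (yjm n i) + 1 := by
  have h1 : Finset.univ.filter (fun a : Fin n => (a : ℕ) < i + 1) =
      insert i (Finset.univ.filter (fun a : Fin n => (a : ℕ) < i)) := by
    ext a
    simp only [Finset.mem_filter, Finset.mem_univ, true_and, Finset.mem_insert, Fin.ext_iff]
    omega
  have h2 : i ∉ Finset.univ.filter (fun a : Fin n => (a : ℕ) < i) := by simp
  have h3 : ρ.asAlgebraHom (yjm n i) =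
      ∑ a ∈ Finset.univ.filter (fun a : Fin n => (a : ℕ) < i), ρ (Equiv.swap a i) := by
    simp only [yjm, map_sum, Representation.asAlgebraHom_of, Fin.lt_def]
  rw [swapSum, swapSum, h1, Finset.sum_insert h2, Finset.sum_insert h2, h3, Equiv.swap_self]
  simp only [Finset.sum_insert h2, Finset.sum_add_distrib, two_smul]
  simp only [Equiv.swap_comm i]
  rw [show (Equiv.refl (Fin n)) = 1 from rfl, map_one]
  abel

/-- Conjugation by `π` permutes the transpositions of the first `i` letters. -/
lemma swapSum_commute (ρ : Representation ℂ (Equiv.Perm (Fin n)) V) {i : ℕ}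
    {π : Equiv.Perm (Fin n)} (hπ : π ∈ youngSub n i) (v : V) :
    swapSum ρ i (ρ π v) = ρ π (swapSum ρ i v) := by
  have hlt : ∀ σ ∈ youngSub n i, ∀ a : Fin n, (a : ℕ) < i → ((σ a : Fin n) : ℕ) < i := by
    intro σ hσ a ha
    by_contra h
    have : σ (σ a) = σ a := hσ _ (not_lt.1 h)
    rw [σ.injective this] at h
    exact h ha
  have key : ∀ {M : Type _} [AddCommMonoid M] (f : Fin n → M),
      ∑ a ∈ Finset.univ.filter (fun a : Fin n => (a : ℕ) < i), f (π a) =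
        ∑ a ∈ Finset.univ.filter (fun a : Fin n => (a : ℕ) < i), f a := by
    intro M _ f
    refine Finset.sum_equiv π (fun a => ?_) fun _ _ => rfl
    simp only [Finset.mem_filter, Finset.mem_univ, true_and]
    refine ⟨hlt π hπ a, fun h => ?_⟩
    simpa using hlt π⁻¹ ((youngSub n i).inv_mem hπ) _ h
  simp only [swapSum, LinearMap.sum_apply, map_sum]
  rw [← key]
  refine Finset.sum_congr rfl fun a _ => ?_
  rw [← key]
  refine Finset.sum_congr rfl fun b _ => ?_
  rw [← Module.End.mul_apply, ← map_mul, ← Module.End.mul_apply, ← map_mul,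
    Equiv.swap_apply_apply]
  simp

/-- Schur's lemma: an eigenspace inside `L` is invariant and nonzero, hence all of `L`. -/
lemma IsIrreducibleSub.exists_swapSum_eq_smul [FiniteDimensional ℂ V]
    {ρ : Representation ℂ (Equiv.Perm (Fin n)) V} {i : ℕ} {L : Submodule ℂ V}
    (hL : IsIrreducibleSub ρ (youngSub n i) L) : ∃ c : ℂ, ∀ v ∈ L, swapSum ρ i v = c • v := by
  have hmem : ∀ v ∈ L, swapSum ρ i v ∈ L := by
    intro v hv
    simp only [swapSum, LinearMap.sum_apply]
    refine L.sum_mem fun a ha => L.sum_mem fun b hb => hL.invariant _ ?_ v hv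
    simp only [Finset.mem_filter, Finset.mem_univ, true_and] at ha hb
    intro j hj
    exact Equiv.swap_apply_of_ne_of_ne (by rintro rfl; omega) (by rintro rfl; omega)
  have : Nontrivial L := Submodule.nontrivial_iff_ne_bot.2 hL.ne_bot
  obtain ⟨c, hc⟩ := Module.End.exists_eigenvalue ((swapSum ρ i).restrict hmem)
  obtain ⟨w, hw⟩ := hc.exists_hasEigenvector
  have hinv : IsInvariant ρ (youngSub n i) (L ⊓ Module.End.eigenspace (swapSum ρ i) c) := by
    rintro π hπ v ⟨hv, hv'⟩
    refine ⟨hL.invariant π hπ v hv, ?_⟩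
    rw [SetLike.mem_coe, Module.End.mem_eigenspace_iff] at hv' ⊢
    rw [swapSum_commute ρ hπ, hv', map_smul]
  refine ⟨c, fun v hv => ?_⟩
  rcases hL.eq_bot_or_eq _ inf_le_left hinv with h | h
  · exfalso
    have hw' : (w : V) ∈ L ⊓ Module.End.eigenspace (swapSum ρ i) c := by
      refine ⟨w.2, Module.End.mem_eigenspace_iff.2 ?_⟩
      exact congrArg Subtype.val hw.apply_eq_smul
    rw [h, Submodule.mem_bot] at hw'
    exact hw.2 (Subtype.ext hw')
  · rw [← h] at hv
    exact Module.End.mem_eigenspace_iff.1 hv.2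

lemma mem_of_mem_one {L : ℕ → Submodule ℂ V} (hle : ∀ i, 1 ≤ i → i < n → L i ≤ L (i + 1)) {v : V}
    (hv : v ∈ L 1) {i : ℕ} (hi : 1 ≤ i) (hi' : i ≤ n) : v ∈ L i := by
  induction i, hi using Nat.le_induction with
  | base => exact hv
  | succ i hi ih => exact hle i hi (by omega) (ih (by omega))

lemma IsGZVector.mem {ρ : Representation ℂ (Equiv.Perm (Fin n)) V} {S : Submodule ℂ V} {v : V}
    (h : IsGZVector ρ S v) (hn : 1 ≤ n) : v ∈ S := by
  obtain ⟨-, L, -, hle, hS, hv⟩ := h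
  exact hS (mem_of_mem_one hle hv hn le_rfl)

lemma IsGZVector.isYJMEigenvector [FiniteDimensional ℂ V]
    {ρ : Representation ℂ (Equiv.Perm (Fin n)) V} {S : Submodule ℂ V} {v : V}
    (h : IsGZVector ρ S v) : IsYJMEigenvector ρ v := by
  obtain ⟨h0, L, hirr, hle, -, hv⟩ := h
  have hswap : ∀ i ≤ n, ∃ c : ℂ, swapSum ρ i v = c • v := by
    intro i hi
    -- Nothing is assumed about `L 0`, but there the operator is an empty sum.
    rcases Nat.eq_zero_or_pos i with rfl | hpos
    · exact ⟨0, by simp [swapSum]⟩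
    · obtain ⟨c, hc⟩ := (hirr i hpos hi).exists_swapSum_eq_smul
      exact ⟨c, hc v (mem_of_mem_one hle hv hpos hi)⟩
  refine ⟨h0, fun i => ?_⟩
  obtain ⟨c, hc⟩ := hswap i i.isLt.le
  obtain ⟨d, hd⟩ := hswap (i + 1) i.isLt
  rw [swapSum_succ, LinearMap.add_apply, LinearMap.add_apply, hc, LinearMap.smul_apply,
    Module.End.one_apply] at hd
  refine ⟨(d - c - 1) / 2, ?_⟩
  have h2 : (2 : ℂ) • ρ.asAlgebraHom (yjm n i) v = (d - c - 1) • v := by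
    rw [sub_smul, sub_smul, ← hd, one_smul]
    abel
  rw [div_eq_inv_mul, ← smul_smul, ← h2, smul_smul, inv_mul_cancel₀ two_ne_zero, one_smul]

end Schur

lemma IsYJMEigenvector.exists_eq_smul_vec {n : ℕ} {v : B n →₀ ℂ} {r : ℕ}
    (h : IsYJMEigenvector (permRep n 1) v) (hr : v ∈ level rk r) :
    ∃ t ∈ labelledChains n, ∃ j, 2 * t.k + j ≤ n ∧ t.k + j = r ∧
      ∃ c : ℂ, c ≠ 0 ∧ v = c • t.vec j := by
  obtain ⟨h0, hα⟩ := h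
  choose α hα using hα
  obtain ⟨t, ht, -, h⟩ := LinearBTK.exists_eq_smul_vec h0 hr (mem_weightSpace.2 hα)
  exact ⟨t, ht, h⟩

lemma isGZBasis_O {n : ℕ} (hn : 1 ≤ n) (r : ℕ) :
    IsGZBasis (permRep n 1) (level rk r) {v ∈ vectors (O n) | v ∈ level rk r} where
  linearIndependent := by
    have h := (linearIndependent_O n).linearIndepOn_id
    rw [range_get_flatten] at h
    exact h.mono fun v hv => hv.1
  span_eq := le_antisymm (Submodule.span_le.2 fun v hv => hv.2) (level_le_span r)
  isGZVector := by
    rintro v ⟨hv, hr⟩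
    obtain ⟨t, ht, j, hj, rfl⟩ := mem_vectors_O.1 hv
    obtain rfl := level_unique ((good_of_mem ht).ne_zero j hj) ((good_of_mem ht).mem_level j) hr
    exact isGZVector_vec ht hj
  exists_smul v hv := by
    obtain ⟨t, ht, j, hj, rfl, c, -, h⟩ := hv.isYJMEigenvector.exists_eq_smul_vec (hv.mem hn)
    exact ⟨t.vec j, ⟨mem_vectors_O.2 ⟨t, ht, j, hj, rfl⟩, (good_of_mem ht).mem_level j⟩, c, h⟩

/-! ## The permutation character as a product of Young–Jucys–Murphy elements -/

/-- The number of elements of `B(n)` that are fixed by a permutation. -/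
def fixedCount {n : ℕ} (σ : Equiv.Perm (Fin n)) : ℕ :=
  (Finset.univ.filter fun a : Fin n → Fin 2 => ∀ i, a (σ i) = a i).card

lemma fixedCount_permCast {n : ℕ} (τ : Equiv.Perm (Fin n)) :
    fixedCount (permCast n τ) = fixedCount τ * 2 := by
  have h2 : fixedCount τ * 2 = ((Finset.univ.filter fun a : Fin n → Fin 2 =>
      ∀ i, a (τ i) = a i) ×ˢ (Finset.univ : Finset (Fin 2))).card := by
    rw [Finset.card_product]
    rfl
  rw [h2, fixedCount]
  refine Finset.card_nbij' (fun a => (Fin.init a, a (Fin.last n)))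
    (fun x => Fin.snoc (α := fun _ => Fin 2) x.1 x.2) ?_ ?_ ?_ ?_
  · intro a ha
    simp only [Finset.coe_filter, Finset.mem_univ, true_and, Set.mem_ofPred_eq] at ha
    simp only [Finset.coe_product, Finset.coe_filter, Finset.mem_univ, true_and, Finset.coe_univ,
      Set.mem_prod, Set.mem_ofPred_eq, Set.mem_univ, and_true]
    intro i
    have := ha i.castSucc
    rwa [permCast_castSucc] at this
  · intro x hx
    simp only [Finset.coe_product, Finset.coe_filter, Finset.mem_univ, true_and, Finset.coe_univ,
      Set.mem_prod, Set.mem_ofPred_eq, Set.mem_univ, and_true] at hx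
    simp only [Finset.coe_filter, Finset.mem_univ, true_and, Set.mem_ofPred_eq]
    intro i
    cases i using Fin.lastCases with
    | last => simp
    | cast i => simpa using hx i
  · intro a _
    exact Fin.snoc_init_self a
  · intro x _
    simp

/-- The product inserts the last letter into the cycle of `τ` after `j`. No cycle is added, so the
value at the last letter is forced to be the value at `j`. -/
lemma fixedCount_permCast_mul_swap {n : ℕ} (τ : Equiv.Perm (Fin n)) (j : Fin n) :
    fixedCount (permCast n τ * Equiv.swap j.castSucc (Fin.last n)) = fixedCount τ := by
  have hj : (permCast n τ * Equiv.swap j.castSucc (Fin.last n)) j.castSucc = Fin.last n := by simp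
  have hl : (permCast n τ * Equiv.swap j.castSucc (Fin.last n)) (Fin.last n) =
      (τ j).castSucc := by simp
  have hi : ∀ i, i ≠ j → (permCast n τ * Equiv.swap j.castSucc (Fin.last n)) i.castSucc =
      (τ i).castSucc := by
    intro i hij
    rw [Equiv.Perm.mul_apply, Equiv.swap_apply_of_ne_of_ne (by simpa using hij)
      (Fin.castSucc_ne_last i), permCast_castSucc]
  rw [fixedCount, fixedCount]
  refine Finset.card_nbij' (fun a => Fin.init a)
    (fun b => Fin.snoc (α := fun _ => Fin 2) b (b j)) ?_ ?_ ?_ ?_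
  · intro a ha
    simp only [Finset.coe_filter, Finset.mem_univ, true_and, Set.mem_ofPred_eq] at ha ⊢
    intro i
    by_cases hij : i = j
    · subst hij
      have h1 := ha i.castSucc
      have h2 := ha (Fin.last n)
      rw [hj] at h1
      rw [hl] at h2
      exact h2.trans h1
    · have h1 := ha i.castSucc
      rwa [hi i hij] at h1
  · intro b hb
    simp only [Finset.coe_filter, Finset.mem_univ, true_and, Set.mem_ofPred_eq] at hb ⊢
    intro i
    cases i using Fin.lastCases with
    | last => rw [hl, Fin.snoc_castSucc, Fin.snoc_last, hb]
    | cast i =>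
      by_cases hij : i = j
      · subst hij
        rw [hj, Fin.snoc_castSucc, Fin.snoc_last]
      · rw [hi i hij, Fin.snoc_castSucc, Fin.snoc_castSucc, hb]
  · intro a ha
    simp only [Finset.coe_filter, Finset.mem_univ, true_and, Set.mem_ofPred_eq] at ha
    have h1 := ha j.castSucc
    rw [hj] at h1
    have h2 : Fin.init (α := fun _ => Fin 2) a j = a (Fin.last n) := h1.symm
    change Fin.snoc (α := fun _ => Fin 2) (Fin.init a) (Fin.init (α := fun _ => Fin 2) a j) = a
    rw [h2, Fin.snoc_init_self]
  · intro b _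
    simp

/-- By the coset decomposition, passing to `n + 1` multiplies the sum by `2 + X_{n+1}`: the trivial
coset doubles the count, and the others leave it unchanged and add up to `X_{n+1}`. -/
lemma sum_fixedCount_smul {n : ℕ} {V : Type*} [AddCommGroup V] [Module ℂ V]
    (ρ : Representation ℂ (Equiv.Perm (Fin n)) V) {α : Fin n → ℂ} {w : V}
    (hw : w ∈ weightSpace ρ α) :
    ∑ σ, (fixedCount σ : ℂ) • ρ σ w = (∏ i, (2 + α i)) • w := by
  induction n with
  | zero =>
    rw [Fintype.sum_unique, Fin.prod_univ_zero, Subsingleton.elim default 1, map_one]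
    simp [fixedCount]
  | succ n ih =>
    rw [mem_weightSpace] at hw
    have hw' : w ∈ weightSpace (ρ.comp (permCast n)) fun i => α i.castSucc :=
      mem_weightSpace.2 fun i => by rw [← yjm_castSucc_apply, hw]
    have hlast := hw (Fin.last n)
    rw [yjm_last_apply] at hlast
    rw [← (bijective_permCast_mul_swap n).sum_comp, Fintype.sum_prod_type, Fin.prod_univ_castSucc,
      mul_comm, ← smul_smul, ← ih _ hw', Finset.smul_sum]
    refine Finset.sum_congr rfl fun τ _ => ?_
    rw [Fin.sum_univ_castSucc]
    simp only [fixedCount_permCast_mul_swap]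
    rw [Equiv.swap_self, show (Equiv.refl (Fin (n + 1))) = 1 from rfl, mul_one,
      fixedCount_permCast, ← Finset.smul_sum]
    simp only [map_mul, Module.End.mul_apply]
    rw [← map_sum, hlast, map_smul, MonoidHom.comp_apply]
    push_cast
    module

/-- The equivariant map from `V(B(n))` that sends `b` to the sum of all `σ w` with `σ a = b`. -/
def orbitHom {n : ℕ} {V : Type*} [AddCommGroup V] [Module ℂ V]
    (ρ : Representation ℂ (Equiv.Perm (Fin n)) V) (a : B n) (w : V) : (B n →₀ ℂ) →ₗ[ℂ] V :=
  Finsupp.linearCombination ℂ fun b : B n =>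
    ∑ σ, if (fun i => a (σ⁻¹ i) : B n) = b then ρ σ w else 0

section Hom

variable {n : ℕ} {V : Type*} [AddCommGroup V] [Module ℂ V]
  (ρ : Representation ℂ (Equiv.Perm (Fin n)) V)

lemma orbitHom_single (a b : B n) (w : V) : orbitHom ρ a w (Finsupp.single b 1) =
    ∑ σ, if (fun i => a (σ⁻¹ i) : B n) = b then ρ σ w else 0 := by
  simp [orbitHom]

lemma orbitHom_permRep (a : B n) (w : V) (π : Equiv.Perm (Fin n)) (v : B n →₀ ℂ) :
    orbitHom ρ a w (permRep n 1 π v) = ρ π (orbitHom ρ a w v) := by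
  revert v
  refine LinearMap.congr_fun (f := orbitHom ρ a w ∘ₗ permRep n 1 π)
    (g := ρ π ∘ₗ orbitHom ρ a w) ?_
  refine Finsupp.lhom_ext' fun b => LinearMap.ext_ring ?_
  simp only [LinearMap.comp_apply, Finsupp.lsingle_apply, permRep_single, orbitHom_single, map_sum]
  conv_lhs => rw [← Equiv.sum_comp (Equiv.mulLeft π)]
  refine Finset.sum_congr rfl fun σ _ => ?_
  have : ∀ a b : Fin n → Fin 2, ((fun i => a ((Equiv.mulLeft π σ)⁻¹ i)) = fun i => b (π⁻¹ i)) ↔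
      (fun i => a (σ⁻¹ i)) = b := by
    intro a b
    constructor
    · intro h
      funext i
      have := congrFun h (π i)
      simpa using this
    · rintro rfl
      rfl
  refine (if_congr (this a b) rfl rfl).trans ?_
  rw [apply_ite (ρ π), map_zero, Equiv.coe_mulLeft, map_mul, Module.End.mul_apply]

/-- A trace computation: `σ` contributes once for each `a` with `σ a = a`. -/
lemma sum_orbitHom (w : V) : ∑ a : B n, orbitHom ρ a w (Finsupp.single a 1) =
    ∑ σ, (fixedCount σ : ℂ) • ρ σ w := by
  simp only [orbitHom_single]
  rw [Finset.sum_comm]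
  refine Finset.sum_congr rfl fun σ _ => ?_
  rw [← Finset.sum_filter, Finset.sum_const, ← Nat.cast_smul_eq_nsmul ℂ]
  have key : ∀ a : Fin n → Fin 2, (fun i => a (σ⁻¹ i)) = a ↔ ∀ i, a (σ i) = a i := by
    intro a
    constructor
    · intro h i
      have := congrFun h (σ i)
      simpa using this.symm
    · intro h
      funext i
      have := h (σ⁻¹ i)
      simpa using this.symm
  congr 3
  exact Finset.filter_congr fun a _ => key a

lemma exists_equivariant_ne_zero {α : Fin n → ℂ} {w : V} (hw : w ∈ weightSpace ρ α) (h0 : w ≠ 0)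
    (hα : ∀ i, 2 + α i ≠ 0) : ∃ ψ : (B n →₀ ℂ) →ₗ[ℂ] V,
      (∀ π v, ψ (permRep n 1 π v) = ρ π (ψ v)) ∧ ∃ v, ψ v ≠ 0 := by
  by_contra! h
  have h1 := sum_orbitHom ρ w
  rw [sum_fixedCount_smul ρ hw,
    Finset.sum_eq_zero fun a _ => h (orbitHom ρ a w) (orbitHom_permRep ρ a w) _] at h1
  exact smul_ne_zero (Finset.prod_ne_zero_iff.2 fun i _ => hα i) h0 h1.symm

end Hom

/-! ## The canonical isomorphisms of weight spaces -/

section Weight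

variable {n : ℕ} {V W : Type*} [AddCommGroup V] [Module ℂ V] [AddCommGroup W] [Module ℂ W]
  {ρ : Representation ℂ (Equiv.Perm (Fin n)) V} {σ : Representation ℂ (Equiv.Perm (Fin n)) W}
  {φ : V →ₗ[ℂ] W}

/-- As `φ` is injective on `L`, eigenvalue equations can be checked after applying it. -/
lemma IsIrreducibleSub.mem_weightSpace_of_map (hφ : ∀ π v, φ (ρ π v) = σ π (φ v))
    {L : Submodule ℂ V} (hL : IsIrreducibleSub ρ ⊤ L) {v : V} (hv : v ∈ L) (h0 : φ v ≠ 0)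
    {γ : Fin n → ℂ} {z : V} (hz : z ∈ L) (hz' : φ z ∈ weightSpace σ γ) :
    z ∈ weightSpace ρ γ := by
  rw [mem_weightSpace] at hz' ⊢
  intro i
  rw [← sub_eq_zero]
  refine hL.eq_zero_of_map_eq_zero hφ hv h0 (L.sub_mem ?_ (L.smul_mem _ hz)) ?_
  · rw [yjm_apply]
    exact L.sum_mem fun j _ => hL.invariant _ trivial z hz
  · rw [map_sub, map_smul, yjm_intertwine ρ σ φ hφ, hz', sub_self]

lemma map_cyclic (hφ : ∀ π v, φ (ρ π v) = σ π (φ v)) (v : V) :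
    (cyclic ρ v).map φ = cyclic σ (φ v) := by
  rw [← orbitSpan_top, ← orbitSpan_top, (intertwines_of_commute hφ ⊤).map_orbitSpan]

end Weight

lemma shift_pow_eq_zero_of_mem_cyclic {n : ℕ} {s : LabelledChain n} (hs : s.Good) {y : B n →₀ ℂ}
    (hy : y ∈ cyclic (permRep n 1) (s.vec 0)) : (shift n 0 1 ^ (n - 2 * s.k + 1)) y = 0 := by
  have hk := hs.two_mul_le
  refine (cyclic_le (S := LinearMap.ker (shift n 0 1 ^ (n - 2 * s.k + 1))) ?_ ?_) hy
  · intro π _ v hv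
    rw [LinearMap.mem_ker] at hv ⊢
    rw [permRep_shift_pow, hv, map_zero]
  · rw [LinearMap.mem_ker, shift_pow_vec hs, hs.eq_zero _ (by omega)]

/-- The weight vectors in an irreducible submodule generated by a bottom element are multiples of
bottom elements of the same rank. -/
lemma exists_vec_zero_mem {n : ℕ} {s : LabelledChain n} (hs : s.Good) {γ : Fin n → ℂ}
    {y : B n →₀ ℂ} (h0 : y ≠ 0) (hy : y ∈ cyclic (permRep n 1) (s.vec 0))
    (hγ : y ∈ weightSpace (permRep n 1) γ) :
    ∃ t ∈ labelledChains n, t.weight = γ ∧ t.k = s.k ∧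
      t.vec 0 ∈ cyclic (permRep n 1) (s.vec 0) := by
  have hk := hs.two_mul_le
  obtain ⟨t, ht, htγ, j, hj, hjk, c, hc, rfl⟩ := exists_eq_smul_vec h0
    (cyclic_le (isInvariant_level n _ _) (hs.mem_level 0) hy) hγ
  have h1 := shift_pow_eq_zero_of_mem_cyclic hs hy
  -- With `t.k + j = s.k`, the vanishing of `t.vec (j + (n - 2 * s.k + 1))` forces `j = 0`: a longer
  -- chain would not have ended yet.
  rw [map_smul, shift_pow_vec (good_of_mem ht), smul_eq_zero, or_iff_right hc] at h1
  obtain rfl : j = 0 := by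
    by_contra hj0
    exact (good_of_mem ht).ne_zero _ (by omega) h1
  refine ⟨t, ht, htγ, by omega, ?_⟩
  have := (cyclic (permRep n 1) (s.vec 0)).smul_mem c⁻¹ hy
  rwa [smul_smul, inv_mul_cancel₀ hc, one_smul] at this

lemma WeightEquiv.symm {n : ℕ} {α β : Fin n → ℂ} (h : WeightEquiv n α β) : WeightEquiv n β α := by
  obtain ⟨L, i1, i2, i3, σ, hσ, hα, hβ⟩ := h
  exact ⟨L, i1, i2, i3, σ, hσ, hβ, hα⟩

/-- A nonzero equivariant map to `L`, composed with a power of `U`, is nonzero on some bottom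
vector. It identifies the module generated by that vector with `L`, and the two weight vectors of
`L` pull back to multiples of bottom vectors. -/
lemma WeightEquiv.exists_labelledChains {n : ℕ} {α β : Fin n → ℂ} (h : WeightEquiv n α β)
    (hα : weightSpace (permRep n 1) α ≠ ⊥) :
    ∃ t ∈ labelledChains n, ∃ u ∈ labelledChains n, t.weight = α ∧ u.weight = β ∧ t.k = u.k ∧
      u.vec 0 ∈ cyclic (permRep n 1) (t.vec 0) := by
  obtain ⟨L, _, _, _, σ, hσ, ⟨v, hv, hv0, -⟩, ⟨w, hw, hw0, -⟩⟩ := h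
  obtain ⟨ψ, hψ, hψ0⟩ : ∃ ψ : (B n →₀ ℂ) →ₗ[ℂ] L,
      (∀ π v, ψ (permRep n 1 π v) = σ π (ψ v)) ∧ ∃ v, ψ v ≠ 0 := by
    refine exists_equivariant_ne_zero σ hv hv0 fun i h => ?_
    obtain ⟨t, ht, rfl⟩ := exists_weight_eq hα
    have h1 := (good_of_mem ht).wt_ge i
    have h2 : (2 + t.wt i : ℤ) = 0 := by
      simp only [LabelledChain.weight] at h
      exact_mod_cast h
    omega
  obtain ⟨s, hs, j, hj, hsj⟩ : ∃ s ∈ labelledChains n, ∃ j, 2 * s.k + j ≤ n ∧ ψ (s.vec j) ≠ 0 := by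
    by_contra! hne
    obtain ⟨x, hx⟩ := hψ0
    have hle : Submodule.span ℂ (vectors (O n)) ≤ LinearMap.ker ψ := by
      refine Submodule.span_le.2 fun y hy => ?_
      obtain ⟨t, ht, j, hj, rfl⟩ := mem_vectors_O.1 hy
      exact hne t ht j hj
    rw [span_vectors_O] at hle
    exact hx (hle trivial)
  have hg := good_of_mem hs
  set φ := ψ ∘ₗ (shift n 0 1 ^ j) with hφdef
  have hφ : ∀ π v, φ (permRep n 1 π v) = σ π (φ v) := fun π v => by
    rw [hφdef, LinearMap.comp_apply, permRep_shift_pow, hψ, LinearMap.comp_apply]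
  have hφ0 : φ (s.vec 0) ≠ 0 := by
    rwa [hφdef, LinearMap.comp_apply, shift_pow_vec hg, zero_add]
  have hirr := isIrreducibleSub_cyclic hs (j := 0) hg.two_mul_le
  have hself := mem_cyclic_self (permRep n 1) (s.vec 0)
  have htop : (cyclic (permRep n 1) (s.vec 0)).map φ = ⊤ := by
    rw [map_cyclic hφ]
    exact hσ.cyclic_eq trivial hφ0
  have key : ∀ (γ : Fin n → ℂ) (x : L), x ∈ weightSpace σ γ → x ≠ 0 →
      ∃ t ∈ labelledChains n, t.weight = γ ∧ t.k = s.k ∧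
        t.vec 0 ∈ cyclic (permRep n 1) (s.vec 0) := by
    intro γ x hx hx0
    obtain ⟨y, hy, rfl⟩ : x ∈ (cyclic (permRep n 1) (s.vec 0)).map φ := htop ▸ trivial
    exact exists_vec_zero_mem hg (fun h => hx0 (by rw [h, map_zero])) hy
      (hirr.mem_weightSpace_of_map hφ hself hφ0 hy hx)
  obtain ⟨t, ht, htα, htk, hts⟩ := key α v hv hv0
  obtain ⟨u, hu, huβ, huk, hus⟩ := key β w hw hw0
  refine ⟨t, ht, u, hu, htα, huβ, htk.trans huk.symm, ?_⟩
  rwa [hirr.cyclic_eq hts ((good_of_mem ht).ne_zero 0 (good_of_mem ht).two_mul_le)]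

lemma exists_basis_weightSpace {n : ℕ} {t : LabelledChain n} (ht : t ∈ labelledChains n) :
    ∃ b : Module.Basis (Fin (n - 2 * t.k + 1)) ℂ (weightSpace (permRep n 1) t.weight),
      ∀ j, (b j : B n →₀ ℂ) = t.vec j := by
  have hg := good_of_mem ht
  have hk := hg.two_mul_le
  have hmem : ∀ j : Fin (n - 2 * t.k + 1), t.vec j ∈ vectors (O n) := fun j =>
    mem_vectors_O.2 ⟨t, ht, j, by omega, rfl⟩
  have hli : LinearIndependent ℂ fun j : Fin (n - 2 * t.k + 1) => t.vec j := by
    have h := (linearIndependent_O n).linearIndepOn_id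
    rw [range_get_flatten] at h
    refine h.linearIndependent.comp (fun j : Fin (n - 2 * t.k + 1) => ⟨t.vec j, hmem j⟩)
      fun i j hij => ?_
    have hij' : t.vec i = t.vec j := congrArg Subtype.val hij
    have := level_unique (hg.ne_zero i (by omega)) (hg.mem_level i) (hij' ▸ hg.mem_level j)
    exact Fin.ext (by omega)
  refine ⟨(Module.Basis.span hli).map (LinearEquiv.ofEq _ _ (weightSpace_eq_span ht).symm),
    fun j => ?_⟩
  rw [Module.Basis.map_apply, LinearEquiv.coe_ofEq_apply, Module.Basis.span_apply]

/-- Take `f` sending `t.vec j` to `u.vec j`. Each `v` is `P (t.vec 0)` for a polynomial `P` in `U`,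
and then `f v = P (u.vec 0)`. Since `P` is equivariant, it carries the known intersection for `t.vec
0` to that for `v`. -/
lemma exists_canonicalIso {n : ℕ} {t u : LabelledChain n} (ht : t ∈ labelledChains n)
    (hu : u ∈ labelledChains n) (hk : t.k = u.k)
    (htu : u.vec 0 ∈ cyclic (permRep n 1) (t.vec 0)) :
    ∃ f : weightSpace (permRep n 1) t.weight ≃ₗ[ℂ] weightSpace (permRep n 1) u.weight,
      IsCanonicalIso (permRep n 1) t.weight u.weight f ∧
      ∀ v : weightSpace (permRep n 1) t.weight, (v : B n →₀ ℂ) ∈ vectors (O n) →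
        (f v : B n →₀ ℂ) ∈ vectors (O n) := by
  have hgt := good_of_mem ht
  have hgu := good_of_mem hu
  obtain ⟨b, hb⟩ := exists_basis_weightSpace ht
  obtain ⟨b', hb'⟩ := exists_basis_weightSpace hu
  have hf : ∀ j, ((b.equiv b' (finCongr (by rw [hk])) (b j) :
      weightSpace (permRep n 1) u.weight) : B n →₀ ℂ) = u.vec j := by
    intro j
    rw [Module.Basis.equiv_apply, hb']
    rfl
  set f := b.equiv b' (finCongr (by rw [hk])) with hfdef
  have hirr := isIrreducibleSub_cyclic ht (j := 0) hgt.two_mul_le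
  have hself := mem_cyclic_self (permRep n 1) (t.vec 0)
  refine ⟨f, fun v => ?_, fun v hv => ?_⟩
  · obtain ⟨P, hP, hPt, hPu⟩ : ∃ P : (B n →₀ ℂ) →ₗ[ℂ] (B n →₀ ℂ),
        (∀ π x, P (permRep n 1 π x) = permRep n 1 π (P x)) ∧ P (t.vec 0) = v ∧
          P (u.vec 0) = f v := by
      refine ⟨∑ j, b.repr v j • shift n 0 1 ^ (j : ℕ), fun π x => ?_, ?_, ?_⟩
      · simp only [LinearMap.sum_apply, LinearMap.smul_apply, permRep_shift_pow, map_sum, map_smul]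
      · conv_rhs => rw [← b.sum_repr v]
        simp only [LinearMap.sum_apply, LinearMap.smul_apply, shift_pow_vec hgt, zero_add,
          Submodule.coe_sum, Submodule.coe_smul, hb]
      · conv_rhs => rw [← b.sum_repr v]
        simp only [LinearMap.sum_apply, LinearMap.smul_apply, shift_pow_vec hgu, zero_add,
          Submodule.coe_sum, Submodule.coe_smul, map_sum, map_smul, hf]
    rw [← hPt, ← map_cyclic hP]
    refine le_antisymm ?_ ?_
    · rintro _ ⟨⟨z, hz, rfl⟩, hz'⟩
      by_cases h0 : P (t.vec 0) = 0
      · have : (cyclic (permRep n 1) (t.vec 0)).map P = ⊥ := by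
          rw [map_cyclic hP, h0]
          simp [cyclic]
        have hz0 : P z ∈ (cyclic (permRep n 1) (t.vec 0)).map P := ⟨z, hz, rfl⟩
        rw [this, Submodule.mem_bot] at hz0
        rw [hz0]
        exact Submodule.zero_mem _
      · have h1 := hirr.mem_weightSpace_of_map hP hself h0 hz hz'
        rw [← hirr.cyclic_eq htu (hgu.ne_zero 0 hgu.two_mul_le)] at hz
        obtain ⟨c, rfl⟩ := exists_smul_of_mem_cyclic hu hz h1
        rw [map_smul, hPu]
        exact Submodule.smul_mem _ _ (Submodule.mem_span_singleton_self _)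
    · rw [Submodule.span_singleton_le_iff_mem]
      exact ⟨⟨_, htu, hPu⟩, (f v).2⟩
  · obtain ⟨s, hs, j, hj, hvj⟩ := mem_vectors_O.1 hv
    obtain rfl := eq_of_weight_eq hs ht ((good_of_mem hs).weight_eq hj (hvj ▸ v.2))
    have hv' : v = b ⟨j, by omega⟩ := Subtype.ext (by rw [hvj, hb])
    rw [hv', hf]
    exact mem_vectors_O.2 ⟨u, hu, j, by omega, rfl⟩

lemma isSGZB_O (n : ℕ) : IsSGZB n 1 (O n) where
  isSJB := isSJB_O n
  eigenvector v hv := ⟨ne_zero_of_mem_vectors_O hv, fun i => exists_yjm_eq_smul i hv⟩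
  transport α β h := by
    -- If `α` does not occur in `V(B(n))`, neither does `β`, and the zero map serves.
    by_cases hα : weightSpace (permRep n 1) α = ⊥
    · have hβ : weightSpace (permRep n 1) β = ⊥ := by
        by_contra hβ
        obtain ⟨_, _, u, hu, _, rfl, -⟩ := h.symm.exists_labelledChains hβ
        have h1 := (good_of_mem hu).mem_weightSpace 0
        rw [hα, Submodule.mem_bot] at h1
        exact (good_of_mem hu).ne_zero 0 (good_of_mem hu).two_mul_le h1
      have hz : ∀ v : weightSpace (permRep n 1) α, (v : B n →₀ ℂ) = 0 := fun v => by
        simpa [hα] using v.2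
      refine ⟨LinearEquiv.ofEq _ _ (hα.trans hβ.symm), fun v => ?_, fun v hv => ?_⟩
      · rw [LinearEquiv.coe_ofEq_apply, hβ, inf_bot_eq, hz, Submodule.span_zero_singleton]
      · exact absurd (hz v) (ne_zero_of_mem_vectors_O hv)
    · obtain ⟨t, ht, u, hu, rfl, rfl, hk, htu⟩ := h.exists_labelledChains hα
      obtain ⟨f, hf, hf'⟩ := exists_canonicalIso ht hu hk htu
      exact ⟨f, hf, fun v hv => ⟨1, by rw [one_smul]; exact hf' v hv⟩⟩

/-! ## Uniqueness -/

/-- The first vector lies on a line of some chain `t`, `U` determines the rest, and `U v_h = 0`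
forces the end to be the top of `t`. Symmetry of the ranks then puts the start at the bottom. -/
lemma exists_eq_map_toList {n : ℕ} {l : List (B n →₀ ℂ)} (hc : IsSymmetricJordanChain rk l)
    (h : ∀ v ∈ l, ∃ t ∈ labelledChains n, ∃ j, 2 * t.k + j ≤ n ∧ ∃ a : ℂ, a ≠ 0 ∧ v = a • t.vec j) :
    ∃ t ∈ labelledChains n, ∃ a : ℂ, a ≠ 0 ∧ l = t.toList.map fun v => a • v := by
  have hpos : 0 < l.length := List.length_pos_of_ne_nil hc.ne_nil
  obtain ⟨t, ht, j, hj, a, ha, hv⟩ := h l[0] (List.getElem_mem hpos)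
  have hg := good_of_mem ht
  have hget : ∀ i (hi : i < l.length), l[i] = a • t.vec (j + i) := by
    intro i
    induction i with
    | zero => exact fun _ => hv
    | succ i ih =>
      intro hi
      have := List.isChain_iff_getElem.1 hc.up_eq i hi
      rw [← this, ih (by omega), upOp_eq_shift, map_smul, hg.up_eq, add_assoc]
  have hlast : l.getLast hc.ne_nil = a • t.vec (j + (l.length - 1)) := by
    rw [List.getLast_eq_getElem, hget]
  have hlast0 : t.vec (j + (l.length - 1)) ≠ 0 := by
    intro h0
    refine hc.ne_zero _ (List.getLast_mem hc.ne_nil) ?_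
    rw [hlast, h0, smul_zero]
  have h1 : 2 * t.k + (j + (l.length - 1)) ≤ n := by
    by_contra h1
    exact hlast0 (hg.eq_zero _ (by omega))
  have h2 : n < 2 * t.k + (j + (l.length - 1) + 1) := by
    by_contra h2
    have h3 := hc.up_last
    rw [hlast, upOp_eq_shift, map_smul, hg.up_eq, smul_eq_zero, or_iff_right ha] at h3
    exact hg.ne_zero _ (by omega) h3
  obtain ⟨r, s, hr, hs, hrs⟩ := hc.symmetric
  rw [sup_rk] at hrs
  have h3 := level_unique (smul_ne_zero ha (hg.ne_zero j hj))
    ((level rk _).smul_mem a (hg.mem_level j)) (by rwa [← hv, ← List.head_eq_getElem hc.ne_nil])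
  have h4 := level_unique (smul_ne_zero ha hlast0)
    ((level rk _).smul_mem a (hg.mem_level _)) (by rwa [← hlast])
  refine ⟨t, ht, a, ha, List.ext_getElem ?_ fun i hi _ => ?_⟩
  · simp only [LabelledChain.toList, List.length_map, List.length_range]
    omega
  · rw [hget i hi]
    simp only [LabelledChain.toList, List.getElem_map, List.getElem_range]
    congr 2
    omega

lemma sameUpToScalars_O {n : ℕ} {L : List (List (B n →₀ ℂ))} (hL : IsSJB rk L)
    (h : ∀ v ∈ vectors L, ∃ t ∈ labelledChains n, ∃ j, 2 * t.k + j ≤ n ∧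
      ∃ a : ℂ, a ≠ 0 ∧ v = a • t.vec j) : SameUpToScalars (O n) L := by
  have key : ∀ c ∈ L, ∃ t ∈ labelledChains n, ∃ a : ℂ, a ≠ 0 ∧ c = t.toList.map fun v => a • v :=
    fun c hc => exists_eq_map_toList (hL.chains c hc) fun v hv => h v ⟨c, hc, hv⟩
  refine ⟨fun c hc => ?_, fun c hc => ?_⟩
  · obtain ⟨t, ht, rfl⟩ := mem_O_iff.1 hc
    have hg := good_of_mem ht
    by_contra! hne
    -- If no multiple of `t` occurred in `L`, all chains of `L` would have other weights, making
    -- `t.vec 0` orthogonal to a spanning set.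
    have horth : ∀ w ∈ Submodule.span ℂ (vectors L), stdInner (t.vec 0) w = 0 := by
      intro w hw
      induction hw using Submodule.span_induction with
      | zero => simp [stdInner]
      | add x y _ _ hx hy =>
        have : stdInner (t.vec 0) (x + y) = stdInner (t.vec 0) x + stdInner (t.vec 0) y := by
          simp [stdInner, mul_add, Finset.sum_add_distrib]
        rw [this, hx, hy, add_zero]
      | smul a x _ hx => rw [stdInner_smul_right, hx, mul_zero]
      | mem x hx =>
        obtain ⟨c, hc, hxc⟩ := hx
        obtain ⟨u, hu, a, ha, rfl⟩ := key c hc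
        obtain ⟨y, hy, rfl⟩ := List.mem_map.1 hxc
        obtain ⟨j, -, rfl⟩ := (good_of_mem hu).mem_toList.1 hy
        rw [stdInner_smul_right, stdInner_eq_zero_of_wt_ne hg (good_of_mem hu), mul_zero]
        intro hwt
        obtain rfl := eq_of_wt_eq ht hu hwt
        exact hne _ hc a ha rfl
    rw [hL.span_eq_top] at horth
    exact stdInner_self_ne_zero (hg.ne_zero 0 hg.two_mul_le) (horth _ trivial)
  · obtain ⟨t, ht, a, ha, rfl⟩ := key c hc
    exact ⟨t.toList, mem_O_iff.2 ⟨t, ht, rfl⟩, a, ha, rfl⟩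

lemma le_of_mem_level {n r : ℕ} {v : B n →₀ ℂ} (h0 : v ≠ 0) (hr : v ∈ level rk r) : r ≤ n := by
  rw [level, Finsupp.mem_supported'] at hr
  by_contra hn
  refine h0 (Finsupp.ext fun a => hr a fun ha => ?_)
  have ha' : rk a = r := ha
  have := rk_le a
  omega

lemma IsSJB.exists_eq_smul_vec {n : ℕ} {L : List (List (B n →₀ ℂ))} (hL : IsSJB rk L)
    (h : ∀ v ∈ vectors L, IsYJMEigenvector (permRep n 1) v) {v : B n →₀ ℂ} (hv : v ∈ vectors L) :
    ∃ t ∈ labelledChains n, ∃ j, 2 * t.k + j ≤ n ∧ ∃ a : ℂ, a ≠ 0 ∧ v = a • t.vec j := by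
  obtain ⟨c, hc, hvc⟩ := hv
  obtain ⟨r, hr⟩ := (hL.chains c hc).homogeneous v hvc
  obtain ⟨t, ht, j, hj, -, ha⟩ := (h v ⟨c, hc, hvc⟩).exists_eq_smul_vec hr
  exact ⟨t, ht, j, hj, ha⟩

lemma IsGZUnion.isYJMEigenvector {n : ℕ} {L : List (List (B n →₀ ℂ))} (hL : IsGZUnion n L)
    {v : B n →₀ ℂ} (hv : v ∈ vectors L) : IsYJMEigenvector (permRep n 1) v := by
  have hv' := hv
  obtain ⟨c, hc, hvc⟩ := hv'
  obtain ⟨r, hr⟩ := (hL.isSJB.chains c hc).homogeneous v hvc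
  have hn := le_of_mem_level ((hL.isSJB.chains c hc).ne_zero v hvc) hr
  exact ((hL.gzBasis r hn).isGZVector v ⟨hv, hr⟩).isYJMEigenvector

lemma isGZUnion_O {n : ℕ} (hn : 1 ≤ n) : IsGZUnion n (O n) where
  isSJB := isSJB_O n
  orthogonal _ hv _ hw := orthogonal_O hv hw
  gzBasis i _ := isGZBasis_O hn i

end LinearBTK

end

theorem theorem3 (n : ℕ) (hn : 1 ≤ n) :
    LinearBTK.IsGZUnion n (LinearBTK.O n) ∧
    LinearBTK.IsSGZB n 1 (LinearBTK.O n) ∧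
    ∀ L : List (List (LinearBTK.B n →₀ ℂ)),
      LinearBTK.IsGZUnion n L ∨ LinearBTK.IsSGZB n 1 L →
        LinearBTK.SameUpToScalars (LinearBTK.O n) L := by
  refine ⟨LinearBTK.isGZUnion_O hn, LinearBTK.isSGZB_O n, ?_⟩
  rintro L (hL | hL)
  · exact LinearBTK.sameUpToScalars_O hL.isSJB fun _ hv =>
      hL.isSJB.exists_eq_smul_vec (fun _ hw => hL.isYJMEigenvector hw) hv
  · exact LinearBTK.sameUpToScalars_O hL.isSJB fun _ hv =>
      hL.isSJB.exists_eq_smul_vec hL.eigenvector hv
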